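/- Let $E$ be a real Banach space with dual $E^*$, let $S=\{S(t)\}_{t\ge 0}$ be a strongly continuous semigroup of bounded operators on $E$, and let $Q\in\mathscr L(E^*,E)$ be positive and symmetric, i.e. $\langle Qx^*,x^*\rangle\ge 0$ and $\langle Qx^*,y^*\rangle=\langle Qy^*,x^*\rangle$ for all $x^*,y^*\in E^*$. For $t>0$ put $Q_tx^*:=\int_0^t S(s)QS^*(s)x^*\,ds$ (a Bochner integral in $E$). Assume that * the weak operator limit $Q_\infty=\lim_{t\to\infty}Q_t$ exists in $\mathscr L(E^*,E)$, i.e. $\langle Q_tx^*,y^*\rangle\to\langle Q_\infty x^*,y^*\rangle$ for all $x^*,y^*\in E^*$; * $Q_\infty$ is the covariance operator of a centered Gaussian Radon measure $\mu$ on $E$. Each $Q_t$, $t>0$, is then the covariance operator of a unique centered Gaussian Radon measure $\mu_t$ on $E$, and the Ornstein-Uhlenbeck transition semigroup is given by $P(t)f(x)=\int_E f(S(t)x+y)\,d\mu_t(y)$ for bounded Borel functions $f:E\to\mathbb C$. It is called strongly Feller if $P(t)f$ is bounded and continuous for all $t>0$ and all bounded Borel $f$. Let $H_\mu$ be the reproducing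 kernel Hilbert space of $\mu$, i.e. the completion of the range of $Q_\infty$ with respect to the inner product $[Q_\infty x^*,Q_\infty y^*]=\langle Q_\infty x^*,y^*\rangle$, and let $i_\mu:H_\mu\hookrightarrow E$ be the continuous injection that extends the inclusion of the range of $Q_\infty$ into $E$. The space $H_\mu$ is invariant under $S$, and $S$ restricts to a strongly continuous semigroup $S_\mu=\{S_\mu(t)\}_{t\ge0}$ on $H_\mu$, i.e. $i_\mu S_\mu(t)=S(t)i_\mu$ for all $t\ge0$. If $P$ is strongly Feller, then $S_\mu$ is compact and strictly contractive: for every $t>0$ the operator $S_\mu(t)$ is compact on $H_\mu$ and $\Vert S_\mu(t)\Vert_{\mathscr L(H_\mu)}<1$. -/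

import Mathlib

open Filter Topology Set MeasureTheory ProbabilityTheory

namespace OrnsteinUhlenbeck

section RKHS

variable {E : Type*} [NormedAddCommGroup E] [NormedSpace ℝ E]

/-- A bounded operator `Q : E* → E` is positive and symmetric:
`⟨Q x*, x*⟩ ≥ 0` and `⟨Q x*, y*⟩ = ⟨Q y*, x*⟩`. -/
structure IsPosSymm (Q : StrongDual ℝ E →L[ℝ] E) : Prop where
  nonneg : ∀ x : StrongDual ℝ E, 0 ≤ x (Q x)
  symm : ∀ x y : StrongDual ℝ E, y (Q x) = x (Q y)

variable {Q : StrongDual ℝ E →L[ℝ] E}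

theorem IsPosSymm.cauchySchwarz (hQ : IsPosSymm Q) (x y : StrongDual ℝ E) :
    (y (Q x)) ^ 2 ≤ x (Q x) * y (Q y) := by
  have key : ∀ a : ℝ, 0 ≤ (x (Q x)) * (a * a) + (2 * y (Q x)) * a + y (Q y) := by
    intro a
    have h := hQ.nonneg (a • x + y)
    have hs := hQ.symm x y
    simp only [map_add, map_smul, add_apply, smul_apply,
      smul_eq_mul] at h
    rw [← hs] at h
    linarith
  have := discrim_le_zero key
  unfold discrim at this
  nlinarith [this]

/-- The range of `Q`, as a vector space without the norm it would inherit from `E`. -/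
def RangeSpace (_hQ : IsPosSymm Q) : Type _ := LinearMap.range (Q : StrongDual ℝ E →ₗ[ℝ] E)

variable (hQ : IsPosSymm Q)

instance : AddCommGroup (RangeSpace hQ) :=
  inferInstanceAs (AddCommGroup (LinearMap.range (Q : StrongDual ℝ E →ₗ[ℝ] E)))

instance : Module ℝ (RangeSpace hQ) :=
  inferInstanceAs (Module ℝ (LinearMap.range (Q : StrongDual ℝ E →ₗ[ℝ] E)))

/-- The inclusion of the range of `Q` into `E`, as a linear map. -/
def RangeSpace.incl : RangeSpace hQ →ₗ[ℝ] E :=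
  (LinearMap.range (Q : StrongDual ℝ E →ₗ[ℝ] E)).subtype

/-- The operator `Q`, viewed as a map onto its range. -/
def RangeSpace.mk : StrongDual ℝ E →ₗ[ℝ] RangeSpace hQ :=
  (Q : StrongDual ℝ E →ₗ[ℝ] E).rangeRestrict

theorem RangeSpace.incl_mk (x : StrongDual ℝ E) :
    RangeSpace.incl hQ (RangeSpace.mk hQ x) = Q x := rfl

theorem RangeSpace.mk_surjective : Function.Surjective (RangeSpace.mk hQ) :=
  LinearMap.surjective_rangeRestrict _

theorem RangeSpace.incl_injective : Function.Injective (RangeSpace.incl hQ) :=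
  Subtype.val_injective

/-- The bilinear form `(Q x*, Q y*) ↦ ⟨Q x*, y*⟩` on the range of `Q`; by the lemma below it does
not depend on the choice of `y*`. -/
noncomputable def RangeSpace.form (u v : RangeSpace hQ) : ℝ :=
  (RangeSpace.mk_surjective hQ v).choose (RangeSpace.incl hQ u)

theorem RangeSpace.form_mk (u : RangeSpace hQ) (y : StrongDual ℝ E) :
    RangeSpace.form hQ u (RangeSpace.mk hQ y) = y (RangeSpace.incl hQ u) := by
  obtain ⟨x, rfl⟩ := RangeSpace.mk_surjective hQ u
  have h := (RangeSpace.mk_surjective hQ (RangeSpace.mk hQ y)).choose_spec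
  have h' := congrArg (RangeSpace.incl hQ) h
  unfold RangeSpace.form
  rw [RangeSpace.incl_mk, RangeSpace.incl_mk] at h'
  rw [RangeSpace.incl_mk, hQ.symm, h', hQ.symm]

/-- The inner product `[Q x*, Q y*] = ⟨Q x*, y*⟩` on the range of `Q`. -/
@[reducible]
noncomputable def RangeSpace.core : InnerProductSpace.Core ℝ (RangeSpace hQ) where
  inner := RangeSpace.form hQ
  conj_inner_symm u v := by
    obtain ⟨x, rfl⟩ := RangeSpace.mk_surjective hQ u
    obtain ⟨y, rfl⟩ := RangeSpace.mk_surjective hQ v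
    simp only [RangeSpace.form_mk, RangeSpace.incl_mk, conj_trivial]
    exact hQ.symm y x
  re_inner_nonneg u := by
    obtain ⟨x, rfl⟩ := RangeSpace.mk_surjective hQ u
    simpa only [RangeSpace.form_mk, RangeSpace.incl_mk, RCLike.re_to_real] using hQ.nonneg x
  add_left u v w := by
    obtain ⟨y, rfl⟩ := RangeSpace.mk_surjective hQ w
    simp only [RangeSpace.form_mk, map_add]
  smul_left u v r := by
    obtain ⟨y, rfl⟩ := RangeSpace.mk_surjective hQ v
    simp only [RangeSpace.form_mk, map_smul, smul_eq_mul, conj_trivial]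
  definite u h := by
    obtain ⟨x, rfl⟩ := RangeSpace.mk_surjective hQ u
    rw [RangeSpace.form_mk, RangeSpace.incl_mk] at h
    apply RangeSpace.incl_injective hQ
    rw [map_zero, RangeSpace.incl_mk]
    refine SeparatingDual.eq_zero_of_forall_dual_eq_zero (R := ℝ) fun y => ?_
    have := hQ.cauchySchwarz x y
    rw [h, zero_mul] at this
    exact pow_eq_zero_iff two_ne_zero |>.1 (le_antisymm this (sq_nonneg _))

noncomputable instance : NormedAddCommGroup (RangeSpace hQ) :=
  (RangeSpace.core hQ).toNormedAddCommGroup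

noncomputable instance : InnerProductSpace ℝ (RangeSpace hQ) :=
  InnerProductSpace.ofCore (RangeSpace.core hQ).toCore

theorem RangeSpace.inner_mk (u : RangeSpace hQ) (y : StrongDual ℝ E) :
    inner ℝ u (RangeSpace.mk hQ y) = y (RangeSpace.incl hQ u) :=
  RangeSpace.form_mk hQ u y

theorem RangeSpace.norm_incl_le (u : RangeSpace hQ) :
    ‖RangeSpace.incl hQ u‖ ≤ Real.sqrt ‖Q‖ * ‖u‖ := by
  obtain ⟨x, rfl⟩ := RangeSpace.mk_surjective hQ u
  rw [RangeSpace.incl_mk]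
  refine NormedSpace.norm_le_dual_bound ℝ _ (by positivity) fun y => ?_
  have h1 := hQ.cauchySchwarz x y
  have h2 : x (Q x) = ‖RangeSpace.mk hQ x‖ ^ 2 := by
    rw [← real_inner_self_eq_norm_sq, RangeSpace.inner_mk, RangeSpace.incl_mk]
  have h3 : y (Q y) ≤ ‖Q‖ * ‖y‖ ^ 2 := by
    calc y (Q y) ≤ ‖y (Q y)‖ := Real.le_norm_self _
      _ ≤ ‖y‖ * (‖Q‖ * ‖y‖) := (y.le_opNorm _).trans (by gcongr; exact Q.le_opNorm y)
      _ = ‖Q‖ * ‖y‖ ^ 2 := by ring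
  rw [h2] at h1
  rw [Real.norm_eq_abs]
  refine abs_le_of_sq_le_sq (h1.trans ?_) (by positivity)
  calc ‖RangeSpace.mk hQ x‖ ^ 2 * y (Q y)
      ≤ ‖RangeSpace.mk hQ x‖ ^ 2 * (‖Q‖ * ‖y‖ ^ 2) := by gcongr
    _ = (Real.sqrt ‖Q‖ * ‖RangeSpace.mk hQ x‖ * ‖y‖) ^ 2 := by
      rw [mul_pow, mul_pow, Real.sq_sqrt (show 0 ≤ ‖Q‖ from norm_nonneg Q)]; ring

/-- The reproducing kernel Hilbert space `H_Q`: the completion of the range of `Q` with respect to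
the inner product `[Q x*, Q y*] = ⟨Q x*, y*⟩`. -/
abbrev RKHSpace : Type _ := UniformSpace.Completion (RangeSpace hQ)

/-- The inclusion of the range of `Q`, with its inner product norm, into `E`. -/
noncomputable def RangeSpace.inclL : RangeSpace hQ →L[ℝ] E :=
  (RangeSpace.incl hQ).mkContinuous (Real.sqrt ‖Q‖) (RangeSpace.norm_incl_le hQ)

/-- The embedding `i_Q : H_Q → E`, the continuous extension of the inclusion of the range. -/
noncomputable def RKHSpace.embed [CompleteSpace E] : RKHSpace hQ →L[ℝ] E :=
  (RangeSpace.inclL hQ).extend (UniformSpace.Completion.toComplL : RangeSpace hQ →L[ℝ] RKHSpace hQ)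

theorem RKHSpace.embed_coe [CompleteSpace E] (u : RangeSpace hQ) :
    RKHSpace.embed hQ (u : RKHSpace hQ) = RangeSpace.incl hQ u :=
  ContinuousLinearMap.extend_eq (RangeSpace.inclL hQ)
    (e := (UniformSpace.Completion.toComplL : RangeSpace hQ →L[ℝ] RKHSpace hQ))
    UniformSpace.Completion.denseRange_coe
    (UniformSpace.Completion.isUniformInducing_coe _) u

/-- The reproducing property `[h, Q x*] = ⟨i_Q h, x*⟩`, i.e. `i_Q^* x* = Q x*`. -/
theorem RKHSpace.inner_mk [CompleteSpace E] (h : RKHSpace hQ) (x : StrongDual ℝ E) :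
    inner ℝ h (RangeSpace.mk hQ x : RKHSpace hQ) = x (RKHSpace.embed hQ h) := by
  induction h using UniformSpace.Completion.induction_on with
  | hp => exact isClosed_eq (by fun_prop) (by fun_prop)
  | ih u =>
    rw [RKHSpace.embed_coe, UniformSpace.Completion.inner_coe, RangeSpace.inner_mk]

/-- `i_Q` is injective, so `H_Q` may be regarded as a linear subspace of `E`. -/
theorem RKHSpace.embed_injective [CompleteSpace E] :
    Function.Injective (RKHSpace.embed hQ) := by
  rw [injective_iff_map_eq_zero]
  intro h h0
  have hz : ∀ g : RKHSpace hQ, inner ℝ h g = 0 := by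
    intro g
    induction g using UniformSpace.Completion.induction_on with
    | hp => exact isClosed_eq (by fun_prop) (by fun_prop)
    | ih u =>
      obtain ⟨x, rfl⟩ := RangeSpace.mk_surjective hQ u
      rw [RKHSpace.inner_mk, h0, map_zero]
  exact inner_self_eq_zero.1 (hz h)

end RKHS

/-- `S = (S(t))_{t ≥ 0}` is a strongly continuous semigroup of bounded operators on `X`
(the values at negative times are irrelevant). -/
structure IsC0Semigroup {X : Type*} [NormedAddCommGroup X] [NormedSpace ℝ X]
    (S : ℝ → X →L[ℝ] X) : Prop where
  map_zero : S 0 = ContinuousLinearMap.id ℝ X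
  map_add : ∀ s t : ℝ, 0 ≤ s → 0 ≤ t → S (s + t) = (S s).comp (S t)
  continuousOn : ∀ x : X, ContinuousOn (fun t => S t x) (Ici 0)

/-- The semigroup `T` is compact: `T(t)` is a compact operator for every `t > 0`. -/
def IsCompactSemigroup {X : Type*} [NormedAddCommGroup X] [NormedSpace ℝ X]
    (T : ℝ → X →L[ℝ] X) : Prop :=
  ∀ t : ℝ, 0 < t → IsCompactOperator (T t)

/-- The semigroup `T` is strictly contractive: `‖T(t)‖ < 1` for every `t > 0`. -/
def IsStrictlyContractive {X : Type*} [NormedAddCommGroup X] [NormedSpace ℝ X]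
    (T : ℝ → X →L[ℝ] X) : Prop :=
  ∀ t : ℝ, 0 < t → ‖T t‖ < 1

section Gaussian

variable {E : Type*} [NormedAddCommGroup E] [NormedSpace ℝ E]

/-- `Q_t x* = ∫_0^t S(s) Q S*(s) x* ds`, a Bochner integral in `E`. -/
noncomputable def covOp (S : ℝ → E →L[ℝ] E) (Q : StrongDual ℝ E →L[ℝ] E) (t : ℝ)
    (x : StrongDual ℝ E) : E :=
  ∫ s in (0 : ℝ)..t, S s (Q (x.comp (S s)))

/-- `Qinf` is the weak operator limit of `Q_t` as `t → ∞`. -/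
def IsWeakLimitCov (S : ℝ → E →L[ℝ] E) (Q Qinf : StrongDual ℝ E →L[ℝ] E) : Prop :=
  ∀ x y : StrongDual ℝ E, Tendsto (fun t : ℝ => y (covOp S Q t x)) atTop (𝓝 (y (Qinf x)))

variable [MeasurableSpace E]

/-- `μ` is a centered Gaussian Radon measure on `E` with covariance operator `R : E* → E`:
`∫ ⟨z, x*⟩ ⟨z, y*⟩ dμ(z) = ⟨R x*, y*⟩`. -/
structure IsCenteredGaussianRadon (μ : Measure E) (R : StrongDual ℝ E → E) : Prop where
  isGaussian : IsGaussian μ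
  innerRegular : μ.InnerRegular
  centered : ∀ x : StrongDual ℝ E, ∫ z, x z ∂μ = 0
  covariance : ∀ x y : StrongDual ℝ E, ∫ z, x z * y z ∂μ = y (R x)

theorem IsCenteredGaussianRadon.isPosSymm {μ : Measure E} {R : StrongDual ℝ E →L[ℝ] E}
    (h : IsCenteredGaussianRadon μ R) : IsPosSymm R where
  nonneg x := by
    rw [← h.covariance]
    exact integral_nonneg fun z => mul_self_nonneg _
  symm x y := by
    rw [← h.covariance, ← h.covariance]
    simp only [mul_comm]

open Classical in
/-- The (unique) centered Gaussian Radon measure with covariance operator `R`, if there is one. -/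
noncomputable def gaussianMeasure (R : StrongDual ℝ E → E) : Measure E :=
  if h : ∃ μ : Measure E, IsCenteredGaussianRadon μ R then h.choose else 0

/-- The transition semigroup `P(t) f (x) = ∫ f(S(t) x + y) dμ_t(y)`, where `μ_t` is the centered
Gaussian Radon measure with covariance operator `Q_t`. -/
noncomputable def transition (S : ℝ → E →L[ℝ] E) (Q : StrongDual ℝ E →L[ℝ] E) (t : ℝ)
    (f : E → ℂ) (x : E) : ℂ :=
  ∫ y, f (S t x + y) ∂(gaussianMeasure (covOp S Q t))

/-- `P` is strongly Feller: for `t > 0`, `P(t)` maps bounded Borel functions to bounded continuous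
functions. -/
def IsStronglyFeller (S : ℝ → E →L[ℝ] E) (Q : StrongDual ℝ E →L[ℝ] E) : Prop :=
  ∀ t : ℝ, 0 < t → ∀ f : E → ℂ, Measurable f → (∃ C : ℝ, ∀ x, ‖f x‖ ≤ C) →
    Continuous (transition S Q t f) ∧ ∃ C : ℝ, ∀ x, ‖transition S Q t f x‖ ≤ C

end Gaussian

end OrnsteinUhlenbeck

/-!
Write `q(x*) = ⟨Q_∞ x*, x*⟩` and `q_t(x*) = ⟨Q_t x*, x*⟩`. The cocycle identity
`Q_{t+r} = Q_t + S(t) Q_r S*(t)` gives, as `r → ∞`, the stationarity identity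
`q(x*) = q_t(x*) + q(S*(t) x*)` (`covOp_eq_sub`), on which everything rests.

*Domination.* Since `Q_t ≤ Q_∞`, each `Q_t` is the covariance of a Gaussian Radon measure
(`exists_isCenteredGaussianRadon_of_add`), so that the transition semigroup is a genuine one. To
see this, add to an isonormal process for `Q_t` an independent variable with law `S(t)_* μ`. The
result is a cylindrical random variable with law `μ`, hence it is induced by an `E`-valued random
variable (`IsCylindrical.exists_random_variable`), whose conditional expectation, defined thanks to
Fernique's theorem, induces the isonormal process.

*Strong Feller property.* If some `S(t) v` were not in the reproducing kernel Hilbert space of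
`Q_t`, there would be a Borel set of full measure for `μ_t` whose translates by `c S(t) v` all have
measure zero for `c ≠ 0`, and `P(t)` would map its indicator to a discontinuous function
(`exists_bound_of_continuous_translate`). By the uniform boundedness principle,
`‖S*(t) x*‖² ≤ K² q_t(x*)` (`IsStronglyFeller.exists_norm_comp_le`).

*Conclusion.* On the one hand, `q(S*(t) x*) ≤ ‖Q_∞‖ K² q_t(x*) = ‖Q_∞‖ K² (q(x*) - q(S*(t) x*))`,
so `q(S*(t) x*) ≤ ρ² q(x*)` with `ρ < 1`, which says that `S(t)` restricts to `H_μ` with norm at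
most `ρ`. On the other hand `‖S*(t) x*‖² ≤ K² q(x*)` says that `S(t)` factors as `i_μ V` with
`V : E → H_μ` bounded, so `S_μ(t) = V i_μ`, and this is compact because the embedding `i_μ` is
(`exists_restriction_of_norm_comp_le`, `IsCenteredGaussianRadon.isCompactOperator_embed`). Strong
continuity of `S_μ` follows from contractivity and weak continuity (`isC0Semigroup_of_contraction`).
-/

namespace OrnsteinUhlenbeck

/-! ### Measurability of weakly continuous functions -/

section WeaklyContinuous

variable {E : Type*} [NormedAddCommGroup E] [NormedSpace ℝ E]

/-- The norm is weakly lower semicontinuous. -/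
theorem lowerSemicontinuous_norm_sub_of_weaklyContinuous {X : Type*} [TopologicalSpace X]
    {g : X → E} (hg : ∀ y : StrongDual ℝ E, Continuous fun s => y (g s)) (z : E) :
    LowerSemicontinuous fun s => ‖g s - z‖ := by
  intro s r hr
  obtain ⟨y, hy1, hy2⟩ := exists_dual_vector'' ℝ (g s - z)
  have hc : Continuous fun s' => y (g s' - z) := by
    simp only [map_sub]
    exact (hg y).sub continuous_const
  have hr' : r < y (g s - z) := by rw [hy2]; exact hr
  filter_upwards [hc.tendsto s |>.eventually (lt_mem_nhds hr')] with s' hs'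
  exact hs'.trans_le ((le_abs_self _).trans
    ((y.le_opNorm _).trans (mul_le_of_le_one_left (norm_nonneg _) hy1)))

/-- The range of a weakly continuous function on a separable space lies in the closed linear span
of its values on a countable dense set. -/
theorem isSeparable_range_of_weaklyContinuous {X : Type*} [TopologicalSpace X]
    [TopologicalSpace.SeparableSpace X]
    {g : X → E} (hg : ∀ y : StrongDual ℝ E, Continuous fun s => y (g s)) :
    TopologicalSpace.IsSeparable (range g) := by
  obtain ⟨D, hDc, hDd⟩ := TopologicalSpace.exists_countable_dense X
  have hsep : TopologicalSpace.IsSeparable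
      ((Submodule.span ℝ (g '' D)).topologicalClosure : Set E) := by
    rw [Submodule.topologicalClosure_coe]
    exact ((hDc.image g).isSeparable.span).closure
  refine hsep.mono ?_
  rintro _ ⟨s, rfl⟩
  by_contra hs
  obtain ⟨y, u, hy1, hy2⟩ := geometric_hahn_banach_closed_point
    (Submodule.convex _) (Submodule.isClosed_topologicalClosure _) hs
  -- a functional bounded above on a subspace vanishes there
  have hy0 : ∀ a ∈ (Submodule.span ℝ (g '' D)).topologicalClosure, y a = 0 := fun a ha => by
    by_contra hne
    have h := hy1 ((u / y a) • a) (Submodule.smul_mem _ _ ha)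
    rw [map_smul, smul_eq_mul, div_mul_cancel₀ _ hne] at h
    exact lt_irrefl _ h
  have hzero : (fun s => y (g s)) = fun _ => 0 :=
    (hg y).ext_on hDd continuous_const fun d hd =>
      hy0 _ (Submodule.le_topologicalClosure _ (Submodule.subset_span (mem_image_of_mem g hd)))
  have h0 := hy1 0 (Submodule.zero_mem _)
  rw [map_zero] at h0
  exact (h0.trans hy2).ne' (congrFun hzero s)

/-- A form of Pettis' measurability theorem: the range is separable, and preimages of balls are
measurable because the norm is weakly lower semicontinuous. -/
theorem stronglyMeasurable_of_weaklyContinuous {X : Type*} [TopologicalSpace X]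
    [TopologicalSpace.SeparableSpace X]
    [MeasurableSpace X] [BorelSpace X]
    {g : X → E} (hg : ∀ y : StrongDual ℝ E, Continuous fun s => y (g s)) :
    StronglyMeasurable g := by
  borelize E
  refine stronglyMeasurable_iff_measurable_separable.2
    ⟨?_, isSeparable_range_of_weaklyContinuous hg⟩
  obtain ⟨D, hDc, hD⟩ := isSeparable_range_of_weaklyContinuous hg
  refine measurable_of_isOpen fun U hU => ?_
  have hball : ∀ d r, MeasurableSet (g ⁻¹' Metric.ball d r) := fun d r => by
    have := (lowerSemicontinuous_norm_sub_of_weaklyContinuous hg d).measurable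
    have h2 : g ⁻¹' Metric.ball d r = (fun s => ‖g s - d‖) ⁻¹' Iio r := by
      ext s; simp [dist_eq_norm]
    rw [h2]
    exact this measurableSet_Iio
  have : g ⁻¹' U = ⋃ d ∈ D, ⋃ q ∈ {q : ℚ | Metric.ball d (q : ℝ) ⊆ U},
      g ⁻¹' Metric.ball d (q : ℝ) := by
    ext s
    simp only [mem_preimage, mem_iUnion, mem_ofPred_eq, exists_prop]
    constructor
    · intro hs
      obtain ⟨ε, hε, hsub⟩ := Metric.isOpen_iff.1 hU _ hs
      obtain ⟨q, hq0, hq1⟩ := exists_rat_btwn (half_pos hε)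
      obtain ⟨d, hd, hdist⟩ := Metric.mem_closure_iff.1 (hD (mem_range_self s)) q hq0
      refine ⟨d, hd, q, fun w hw => hsub ?_, hdist⟩
      have h1 : dist w d < q := hw
      have h2 := dist_triangle_right w (g s) d
      rw [Metric.mem_ball]; linarith
    · rintro ⟨d, -, q, hq, hs⟩
      exact hq hs
  rw [this]
  exact MeasurableSet.biUnion hDc fun d _ =>
    MeasurableSet.biUnion (to_countable _) fun q _ => hball d q

end WeaklyContinuous

/-! ### The operators `Q_t` -/

section Covariance

variable {E : Type*} [NormedAddCommGroup E] [NormedSpace ℝ E]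
  {S : ℝ → E →L[ℝ] E} {Q Qinf : StrongDual ℝ E →L[ℝ] E}

theorem IsC0Semigroup.continuous_max (hS : IsC0Semigroup S) (v : E) :
    Continuous fun s => S (max s 0) v :=
  (hS.continuousOn v).comp_continuous (by fun_prop) fun s => le_max_right s 0

/-- A strongly continuous semigroup is bounded on bounded time intervals. -/
theorem IsC0Semigroup.exists_norm_le [CompleteSpace E] (hS : IsC0Semigroup S) (t : ℝ) :
    ∃ M : ℝ, 0 ≤ M ∧ ∀ s ∈ Icc 0 t, ‖S s‖ ≤ M := by
  obtain ⟨M, hM⟩ := banach_steinhaus (g := fun s : Icc (0 : ℝ) t => S s) fun v => by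
    obtain ⟨C, hC⟩ := isCompact_Icc.exists_bound_of_continuousOn
      ((hS.continuousOn v).mono (fun s hs => hs.1))
    exact ⟨C, fun s => hC s s.2⟩
  exact ⟨max M 0, le_max_right _ _, fun s hs => (hM ⟨s, hs⟩).trans (le_max_left _ _)⟩

/-- The integrand `s ↦ S(s) Q S*(s) x*` of `Q_t x*` is Bochner integrable on bounded intervals:
since `Q` is symmetric, `s ↦ Q S*(s) x*` is weakly continuous, hence strongly measurable. -/
theorem intervalIntegrable_covOp [CompleteSpace E] (hS : IsC0Semigroup S) (hQ : IsPosSymm Q)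
    (x : StrongDual ℝ E) {a b : ℝ} (ha : 0 ≤ a) (hab : a ≤ b) :
    IntervalIntegrable (fun s => S s (Q (x.comp (S s)))) volume a b := by
  have hg : StronglyMeasurable fun s : ℝ => Q (x.comp (S (max s 0))) := by
    refine stronglyMeasurable_of_weaklyContinuous fun y => ?_
    have : (fun s : ℝ => y (Q (x.comp (S (max s 0))))) = fun s => x (S (max s 0) (Q y)) := by
      ext s; rw [hQ.symm]; rfl
    rw [this]
    exact x.continuous.comp (hS.continuous_max _)
  have hu := stronglyMeasurable_uncurry_of_continuous_of_stronglyMeasurable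
    (u := fun (t s : ℝ) => S (max t 0) (Q (x.comp (S (max s 0)))))
    (fun s => hS.continuous_max _)
    (fun t => (S (max t 0)).continuous.comp_stronglyMeasurable hg)
  have hf : StronglyMeasurable fun s : ℝ => S (max s 0) (Q (x.comp (S (max s 0)))) :=
    hu.comp_measurable (measurable_id.prodMk measurable_id)
  obtain ⟨M, hM0, hM⟩ := hS.exists_norm_le b
  rw [intervalIntegrable_iff_integrableOn_Ioc_of_le hab]
  have hfi : IntegrableOn (fun s : ℝ => S (max s 0) (Q (x.comp (S (max s 0))))) (Ioc a b) := by
    refine Integrable.of_bound (C := M * (‖Q‖ * (‖x‖ * M))) hf.aestronglyMeasurable ?_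
    refine (ae_restrict_iff' measurableSet_Ioc).2 (ae_of_all _ fun s hs => ?_)
    have hs0 : 0 ≤ s := ha.trans hs.1.le
    rw [max_eq_left hs0]
    have h1 := hM s ⟨hs0, hs.2⟩
    calc ‖S s (Q (x.comp (S s)))‖ ≤ ‖S s‖ * (‖Q‖ * (‖x‖ * ‖S s‖)) :=
          (S s).le_opNorm_of_le (Q.le_opNorm_of_le (x.opNorm_comp_le _))
      _ ≤ _ := by gcongr
  refine hfi.congr_fun (fun s hs => ?_) measurableSet_Ioc
  simp only [max_eq_left (ha.trans hs.1.le)]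

theorem apply_covOp [CompleteSpace E] (hS : IsC0Semigroup S) (hQ : IsPosSymm Q)
    (x y : StrongDual ℝ E) {t : ℝ} (ht : 0 ≤ t) :
    y (covOp S Q t x) = ∫ s in (0 : ℝ)..t, y (S s (Q (x.comp (S s)))) :=
  (y.intervalIntegral_comp_comm (intervalIntegrable_covOp hS hQ x le_rfl ht)).symm

theorem covOp_self_nonneg [CompleteSpace E] (hS : IsC0Semigroup S) (hQ : IsPosSymm Q)
    (x : StrongDual ℝ E) {t : ℝ} (ht : 0 ≤ t) : 0 ≤ x (covOp S Q t x) := by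
  rw [apply_covOp hS hQ x x ht]
  exact intervalIntegral.integral_nonneg_of_forall ht fun s => hQ.nonneg (x.comp (S s))

/-- The cocycle identity `Q_{t+r} = Q_t + S(t) Q_r S*(t)`. -/
theorem covOp_add [CompleteSpace E] (hS : IsC0Semigroup S) (hQ : IsPosSymm Q)
    (x : StrongDual ℝ E) {t r : ℝ} (ht : 0 ≤ t) (hr : 0 ≤ r) :
    covOp S Q (t + r) x = covOp S Q t x + S t (covOp S Q r (x.comp (S t))) := by
  have h1 := intervalIntegrable_covOp hS hQ x le_rfl ht
  have h2 := intervalIntegrable_covOp hS hQ x ht (le_add_of_nonneg_right hr)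
  have h3 : ∫ s in t..(t + r), S s (Q (x.comp (S s)))
      = S t (covOp S Q r (x.comp (S t))) := by
    unfold covOp
    rw [← (S t).intervalIntegral_comp_comm
      (intervalIntegrable_covOp hS hQ (x.comp (S t)) le_rfl hr)]
    have h4 := intervalIntegral.integral_comp_add_left (a := 0) (b := r)
      (fun s => S s (Q (x.comp (S s)))) t
    rw [add_zero] at h4
    rw [← h4]
    refine intervalIntegral.integral_congr fun s hs => ?_
    rw [uIcc_of_le hr] at hs
    simp only [hS.map_add t s ht hs.1]
    rfl
  rw [← h3]
  exact (intervalIntegral.integral_add_adjacent_intervals h1 h2).symm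

/-- The stationarity identity `Q_∞ = Q_t + S(t) Q_∞ S*(t)`. -/
theorem covOp_eq_sub [CompleteSpace E] (hS : IsC0Semigroup S) (hQ : IsPosSymm Q)
    (hQinf : IsWeakLimitCov S Q Qinf) (x : StrongDual ℝ E) {t : ℝ} (ht : 0 ≤ t) :
    covOp S Q t x = Qinf x - S t (Qinf (x.comp (S t))) := by
  refine (SeparatingDual.eq_iff_forall_dual_eq (R := ℝ)).2 fun y => ?_
  have h1 : Tendsto (fun r : ℝ => y (covOp S Q (t + r) x)) atTop (𝓝 (y (Qinf x))) :=
    (hQinf x y).comp (tendsto_atTop_add_const_left _ t tendsto_id)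
  have h2 : Tendsto (fun r : ℝ => y (covOp S Q t x) + y (S t (covOp S Q r (x.comp (S t)))))
      atTop (𝓝 (y (covOp S Q t x) + y (S t (Qinf (x.comp (S t)))))) :=
    tendsto_const_nhds.add (hQinf (x.comp (S t)) (y.comp (S t)))
  have h3 := tendsto_nhds_unique_of_eventuallyEq h1 h2
    ((eventually_ge_atTop 0).mono fun r hr => by
      simp only [covOp_add hS hQ x ht hr, map_add])
  rw [map_sub, h3, add_sub_cancel_right]

/-- The operator `Q_t = Q_∞ - S(t) Q_∞ S*(t)` as a bounded operator. -/
noncomputable def covCLM (S : ℝ → E →L[ℝ] E) (Qinf : StrongDual ℝ E →L[ℝ] E) (t : ℝ) :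
    StrongDual ℝ E →L[ℝ] E :=
  Qinf - (S t).comp (Qinf.comp ((ContinuousLinearMap.compL ℝ E E ℝ).flip (S t)))

theorem covCLM_apply (t : ℝ) (x : StrongDual ℝ E) :
    covCLM S Qinf t x = Qinf x - S t (Qinf (x.comp (S t))) := rfl

theorem covOp_eq_covCLM [CompleteSpace E] (hS : IsC0Semigroup S) (hQ : IsPosSymm Q)
    (hQinf : IsWeakLimitCov S Q Qinf) {t : ℝ} (ht : 0 ≤ t) :
    covOp S Q t = covCLM S Qinf t :=
  funext fun x => covOp_eq_sub hS hQ hQinf x ht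

theorem isPosSymm_covCLM [CompleteSpace E] (hS : IsC0Semigroup S) (hQ : IsPosSymm Q)
    (hQinf : IsWeakLimitCov S Q Qinf) (hsymm : IsPosSymm Qinf) {t : ℝ} (ht : 0 ≤ t) :
    IsPosSymm (covCLM S Qinf t) where
  nonneg x := by
    rw [← covOp_eq_covCLM hS hQ hQinf ht]
    exact covOp_self_nonneg hS hQ x ht
  symm x y := by
    simp only [covCLM_apply, map_sub]
    rw [hsymm.symm x y]
    exact congrArg _ (hsymm.symm (x.comp (S t)) (y.comp (S t)))

end Covariance

/-! ### Factoring operators through the reproducing kernel Hilbert space -/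

section Factor

variable {E : Type*} [NormedAddCommGroup E] [NormedSpace ℝ E]
  {Q : StrongDual ℝ E →L[ℝ] E} (hQ : IsPosSymm Q)

theorem RangeSpace.norm_mk_sq (x : StrongDual ℝ E) : ‖RangeSpace.mk hQ x‖ ^ 2 = x (Q x) := by
  rw [← real_inner_self_eq_norm_sq, RangeSpace.inner_mk, RangeSpace.incl_mk]

theorem RangeSpace.norm_mk (x : StrongDual ℝ E) : ‖RangeSpace.mk hQ x‖ = √(x (Q x)) := by
  rw [← RangeSpace.norm_mk_sq hQ, Real.sqrt_sq (norm_nonneg _)]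

variable [CompleteSpace E]

theorem RKHSpace.abs_apply_embed_le (h : RKHSpace hQ) (x : StrongDual ℝ E) :
    |x (RKHSpace.embed hQ h)| ≤ ‖h‖ * √(x (Q x)) := by
  rw [← RKHSpace.inner_mk hQ h x]
  refine (abs_real_inner_le_norm _ _).trans ?_
  rw [UniformSpace.Completion.norm_coe, RangeSpace.norm_mk]

/-- A vector `v` lies in `H_Q` as soon as `x* ↦ ⟨v, x*⟩` is bounded by the seminorm
`x* ↦ ⟨Q x*, x*⟩^{1/2}`: the functional `Q x* ↦ ⟨v, x*⟩` is then represented by an element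
of `H_Q`. -/
theorem RKHSpace.exists_embed_eq {v : E} {C : ℝ} (hC : 0 ≤ C)
    (hv : ∀ x : StrongDual ℝ E, |x v| ≤ C * √(x (Q x))) :
    ∃ h : RKHSpace hQ, RKHSpace.embed hQ h = v ∧ ‖h‖ ≤ C := by
  have hker : (ContinuousLinearMap.apply ℝ ℝ v : StrongDual ℝ E →ₗ[ℝ] ℝ) ∈
      LinearMap.range (RangeSpace.mk hQ).dualMap := by
    rw [LinearMap.range_dualMap_eq_dualAnnihilator_ker, Submodule.mem_dualAnnihilator]
    intro x hx
    have h1 := hv x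
    rw [← RangeSpace.norm_mk hQ, LinearMap.mem_ker.1 hx, norm_zero, mul_zero] at h1
    exact abs_nonpos_iff.1 h1
  obtain ⟨φ, hφ⟩ := hker
  have hφmk : ∀ x, φ (RangeSpace.mk hQ x) = x v := fun x => LinearMap.congr_fun hφ x
  have hφC : ∀ u, ‖φ u‖ ≤ C * ‖u‖ := fun u => by
    obtain ⟨x, rfl⟩ := RangeSpace.mk_surjective hQ u
    rw [hφmk, RangeSpace.norm_mk]
    exact hv x
  let Φ : StrongDual ℝ (RKHSpace hQ) := (φ.mkContinuous C hφC).extend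
    (UniformSpace.Completion.toComplL : RangeSpace hQ →L[ℝ] RKHSpace hQ)
  have hΦ : ∀ u : RangeSpace hQ, Φ (u : RKHSpace hQ) = φ u := fun u =>
    ContinuousLinearMap.extend_eq (φ.mkContinuous C hφC)
      (e := (UniformSpace.Completion.toComplL : RangeSpace hQ →L[ℝ] RKHSpace hQ))
      UniformSpace.Completion.denseRange_coe
      (UniformSpace.Completion.isUniformInducing_coe _) u
  have hΦC : ‖Φ‖ ≤ C := by
    refine Φ.opNorm_le_bound hC fun g => ?_
    induction g using UniformSpace.Completion.induction_on with
    | hp => exact isClosed_le (by fun_prop) (by fun_prop)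
    | ih u =>
      rw [hΦ, UniformSpace.Completion.norm_coe]
      exact hφC u
  refine ⟨(InnerProductSpace.toDual ℝ (RKHSpace hQ)).symm Φ, ?_, by simpa using hΦC⟩
  refine (SeparatingDual.eq_iff_forall_dual_eq (R := ℝ)).2 fun x => ?_
  rw [← RKHSpace.inner_mk, InnerProductSpace.toDual_symm_apply, hΦ, hφmk]

/-- An operator `T : F → E` with `|⟨T f, x*⟩| ≤ C ‖f‖ ⟨Q x*, x*⟩^{1/2}` factors through the
embedding of `H_Q`. -/
theorem RKHSpace.exists_lift {F : Type*} [NormedAddCommGroup F] [NormedSpace ℝ F]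
    (T : F →L[ℝ] E) {C : ℝ} (hC : 0 ≤ C)
    (hT : ∀ (f : F) (x : StrongDual ℝ E), |x (T f)| ≤ C * ‖f‖ * √(x (Q x))) :
    ∃ V : F →L[ℝ] RKHSpace hQ, (∀ f, RKHSpace.embed hQ (V f) = T f) ∧ ‖V‖ ≤ C := by
  choose V hV hVC using fun f => RKHSpace.exists_embed_eq hQ (mul_nonneg hC (norm_nonneg f)) (hT f)
  have hinj := RKHSpace.embed_injective hQ
  let V' : F →ₗ[ℝ] RKHSpace hQ :=
    { toFun := V
      map_add' := fun f g => hinj (by rw [map_add, hV, hV, hV, map_add])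
      map_smul' := fun c f => hinj (by rw [RingHom.id_apply, map_smul, hV, hV, map_smul]) }
  exact ⟨V'.mkContinuous C hVC, hV, V'.mkContinuous_norm_le hC hVC⟩

end Factor

section ContractionSemigroup

/-- A contraction semigroup on a real Hilbert space is strongly continuous as soon as
`t ↦ ⟪h, T(t) h⟫` is right continuous at `0`, since
`‖T(t) h - h‖² ≤ 2 ‖h‖² - 2 ⟪h, T(t) h⟫`. -/
theorem isC0Semigroup_of_contraction {H : Type*} [NormedAddCommGroup H] [InnerProductSpace ℝ H]
    {T : ℝ → H →L[ℝ] H} (h0 : T 0 = ContinuousLinearMap.id ℝ H)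
    (hadd : ∀ s t : ℝ, 0 ≤ s → 0 ≤ t → T (s + t) = (T s).comp (T t))
    (hle : ∀ t : ℝ, 0 ≤ t → ‖T t‖ ≤ 1)
    (hweak : ∀ h : H, Tendsto (fun t => inner ℝ h (T t h)) (𝓝[≥] 0) (𝓝 (inner ℝ h h))) :
    IsC0Semigroup T := by
  have hcontr : ∀ t, 0 ≤ t → ∀ h, ‖T t h‖ ≤ ‖h‖ := fun t ht h => by
    simpa using (T t).le_of_opNorm_le (hle t ht) h
  have hzero : ∀ h : H, Tendsto (fun t => ‖T t h - h‖) (𝓝[≥] 0) (𝓝 0) := fun h => by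
    have h1 : Tendsto (fun t => √(2 * ‖h‖ ^ 2 - 2 * inner ℝ h (T t h))) (𝓝[≥] 0) (𝓝 0) := by
      have h2 := (((hweak h).const_mul 2).const_sub (2 * ‖h‖ ^ 2)).sqrt
      rwa [real_inner_self_eq_norm_sq, sub_self, Real.sqrt_zero] at h2
    refine squeeze_zero' (Eventually.of_forall fun _ => norm_nonneg _) ?_ h1
    filter_upwards [self_mem_nhdsWithin] with t ht
    refine Real.le_sqrt_of_sq_le ?_
    rw [norm_sub_sq_real, real_inner_comm]
    have := pow_le_pow_left₀ (norm_nonneg _) (hcontr t ht h) 2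
    linarith
  refine ⟨h0, hadd, fun h s hs => ?_⟩
  have hbound : ∀ t ∈ Ici (0 : ℝ), ‖T t h - T s h‖ ≤ ‖T |t - s| h - h‖ := by
    have key : ∀ a b : ℝ, 0 ≤ a → a ≤ b → ‖T b h - T a h‖ ≤ ‖T (b - a) h - h‖ := by
      intro a b ha hab
      have h3 := hadd a (b - a) ha (sub_nonneg.2 hab)
      rw [add_sub_cancel] at h3
      rw [h3, ContinuousLinearMap.comp_apply, ← map_sub]
      exact hcontr a ha _
    intro t ht
    rcases le_total s t with hst | hts
    · rw [abs_of_nonneg (sub_nonneg.2 hst)]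
      exact key s t hs hst
    · rw [abs_sub_comm, abs_of_nonneg (sub_nonneg.2 hts), norm_sub_rev]
      exact key t s ht hts
  rw [ContinuousWithinAt, tendsto_iff_norm_sub_tendsto_zero]
  have habs : Tendsto (fun t : ℝ => |t - s|) (𝓝[Ici 0] s) (𝓝[≥] 0) := by
    refine tendsto_nhdsWithin_iff.2 ⟨?_, Eventually.of_forall fun t => mem_Ici.2 (abs_nonneg _)⟩
    have : Continuous fun t : ℝ => |t - s| := by fun_prop
    simpa using (this.tendsto s).mono_left nhdsWithin_le_nhds
  refine squeeze_zero' (Eventually.of_forall fun _ => norm_nonneg _) ?_ ((hzero h).comp habs)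
  filter_upwards [self_mem_nhdsWithin] with t ht using hbound t ht

variable {E : Type*} [NormedAddCommGroup E] [NormedSpace ℝ E] [CompleteSpace E]
  {Q : StrongDual ℝ E →L[ℝ] E} (hQ : IsPosSymm Q)

/-- A family of contractions on `H_Q` that intertwines with a strongly continuous semigroup on `E`
is a strongly continuous semigroup. -/
theorem isC0Semigroup_of_embed_eq {S : ℝ → E →L[ℝ] E} (hS : IsC0Semigroup S)
    {T : ℝ → RKHSpace hQ →L[ℝ] RKHSpace hQ}
    (hT : ∀ t : ℝ, 0 ≤ t → ∀ h, RKHSpace.embed hQ (T t h) = S t (RKHSpace.embed hQ h))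
    (hle : ∀ t : ℝ, 0 ≤ t → ‖T t‖ ≤ 1) : IsC0Semigroup T := by
  have hinj := RKHSpace.embed_injective hQ
  refine isC0Semigroup_of_contraction ?_ ?_ hle fun h => ?_
  · ext h
    apply hinj
    rw [hT 0 le_rfl, hS.map_zero]
    rfl
  · intro s t hs ht
    ext h
    apply hinj
    rw [hT _ (add_nonneg hs ht), hS.map_add s t hs ht]
    simp only [ContinuousLinearMap.comp_apply, hT s hs, hT t ht]
  · -- pairings with the dense range of `Q` are orbits of `S` in `E`; contractivity extends
    -- the convergence to all pairings
    have hcontr : ∀ t, 0 ≤ t → ‖T t h‖ ≤ ‖h‖ := fun t ht => by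
      simpa using (T t).le_of_opNorm_le (hle t ht) h
    have hdense : ∀ u : RangeSpace hQ, Tendsto (fun t => inner ℝ (u : RKHSpace hQ) (T t h))
        (𝓝[≥] 0) (𝓝 (inner ℝ (u : RKHSpace hQ) h)) := fun u => by
      obtain ⟨x, rfl⟩ := RangeSpace.mk_surjective hQ u
      rw [real_inner_comm, RKHSpace.inner_mk]
      have h1 := (x.continuous.tendsto _).comp
        ((hS.continuousOn (RKHSpace.embed hQ h)) 0 self_mem_Ici).tendsto
      rw [hS.map_zero] at h1
      refine h1.congr' ?_
      filter_upwards [self_mem_nhdsWithin] with t ht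
      rw [real_inner_comm, RKHSpace.inner_mk, hT t ht]
      rfl
    have hclosed : ∀ g : RKHSpace hQ, Tendsto (fun t => inner ℝ g (T t h))
        (𝓝[≥] 0) (𝓝 (inner ℝ g h)) := fun g => by
      rw [Metric.tendsto_nhds]
      intro ε hε
      have hpos : 0 < ε / (2 * (‖h‖ + 1) * 2) := by positivity
      obtain ⟨u, hu⟩ := UniformSpace.Completion.denseRange_coe.exists_dist_lt g hpos
      rw [dist_eq_norm] at hu
      filter_upwards [(Metric.tendsto_nhds.1 (hdense u)) (ε / 2) (half_pos hε),
        self_mem_nhdsWithin] with t h1 ht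
      rw [Real.dist_eq, ← inner_sub_right] at h1 ⊢
      have h2 : ‖T t h - h‖ ≤ 2 * (‖h‖ + 1) := by
        have := norm_sub_le (T t h) h
        have := hcontr t ht
        linarith
      have h3 : |inner ℝ (g - u) (T t h - h)| ≤ ε / 2 := by
        refine (abs_real_inner_le_norm _ _).trans ?_
        calc ‖g - u‖ * ‖T t h - h‖ ≤ ε / (2 * (‖h‖ + 1) * 2) * (2 * (‖h‖ + 1)) := by
              gcongr
          _ = ε / 2 := by field_simp
      have h4 : inner ℝ g (T t h - h)
          = inner ℝ (g - u) (T t h - h) + inner ℝ (u : RKHSpace hQ) (T t h - h) := by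
        rw [inner_sub_left, sub_add_cancel]
      rw [h4]
      exact (abs_add_le _ _).trans_lt (by linarith)
    exact hclosed h

end ContractionSemigroup

/-! ### Gaussian Radon measures: separable support and compactness of the embedding -/

section Support

variable {E : Type*} [NormedAddCommGroup E] [NormedSpace ℝ E] [MeasurableSpace E] [BorelSpace E]

/-- A Radon probability measure is carried by the closed linear span of countably many compact
sets. -/
theorem exists_separable_submodule (μ : Measure E) [IsProbabilityMeasure μ] [μ.InnerRegular] :
    ∃ F : Submodule ℝ E, IsClosed (F : Set E) ∧ TopologicalSpace.IsSeparable (F : Set E) ∧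
      μ (F : Set E)ᶜ = 0 := by
  have hK : ∀ n : ℕ, ∃ K : Set E, IsCompact K ∧ 1 - ((n : ENNReal) + 1)⁻¹ < μ K := fun n => by
    obtain ⟨K, -, hK, hlt⟩ := MeasurableSet.univ.exists_lt_isCompact (μ := μ)
      (r := 1 - ((n : ENNReal) + 1)⁻¹)
      (by rw [measure_univ]; exact ENNReal.sub_lt_self (by simp) (by simp) (by simp))
    exact ⟨K, hK, hlt⟩
  choose K hKc hKμ using hK
  have hUs : TopologicalSpace.IsSeparable (⋃ n, K n) :=
    .iUnion fun n => (hKc n).isSeparable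
  refine ⟨(Submodule.span ℝ (⋃ n, K n)).topologicalClosure,
    Submodule.isClosed_topologicalClosure _, ?_, ?_⟩
  · rw [Submodule.topologicalClosure_coe]
    exact hUs.span.closure
  · have hcl : IsClosed ((Submodule.span ℝ (⋃ n, K n)).topologicalClosure : Set E) :=
      Submodule.isClosed_topologicalClosure _
    rw [prob_compl_eq_zero_iff hcl.measurableSet]
    refine le_antisymm prob_le_one ?_
    have hlim : Tendsto (fun n : ℕ => 1 - ((n : ENNReal) + 1)⁻¹) atTop (𝓝 1) := by
      have h1 : Tendsto (fun n : ℕ => ((n + 1 : ℕ) : ENNReal)⁻¹) atTop (𝓝 0) :=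
        ENNReal.tendsto_inv_nat_nhds_zero.comp (tendsto_add_atTop_nat 1)
      have h2 := ENNReal.Tendsto.sub (tendsto_const_nhds (x := (1 : ENNReal))) h1 (by simp)
      simpa using h2
    refine le_of_tendsto' hlim fun n => (hKμ n).le.trans (measure_mono ?_)
    exact (subset_iUnion K n).trans
      (Submodule.subset_span.trans (Submodule.le_topologicalClosure _))

/-- A Gaussian Radon measure is the image of a Gaussian measure on a closed separable
subspace. -/
theorem IsCenteredGaussianRadon.exists_separable {μ : Measure E} {R : StrongDual ℝ E → E}
    (h : IsCenteredGaussianRadon μ R) :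
    ∃ F : Submodule ℝ E, IsClosed (F : Set E) ∧ TopologicalSpace.SeparableSpace F ∧
      ∃ μ₀ : Measure F, IsGaussian μ₀ ∧ μ₀.map F.subtypeL = μ := by
  have := h.isGaussian
  have := h.innerRegular
  obtain ⟨F, hF, hs, h0⟩ := exists_separable_submodule μ
  have hemb : MeasurableEmbedding (Subtype.val : F → E) := .subtype_coe hF.measurableSet
  have hmap : (μ.comap (Subtype.val : F → E)).map F.subtypeL = μ := by
    have h1 : ((F.subtypeL : F →L[ℝ] E) : F → E) = Subtype.val := rfl
    rw [h1, hemb.map_comap, Subtype.range_coe, Measure.restrict_eq_self_of_ae_mem]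
    exact h0
  refine ⟨F, hF, hs.separableSpace, μ.comap (Subtype.val : F → E), ?_, hmap⟩
  refine isGaussian_of_isGaussian_map fun L => ?_
  obtain ⟨L', hL', -⟩ := exists_extension_norm_eq F L
  have h2 : (L : F → ℝ) = L' ∘ F.subtypeL := by
    ext z; exact (hL' z).symm
  rw [h2, ← Measure.map_map L'.continuous.measurable F.subtypeL.continuous.measurable, hmap]
  infer_instance

theorem IsCenteredGaussianRadon.memLp_id [CompleteSpace E] {μ : Measure E}
    {R : StrongDual ℝ E → E} (h : IsCenteredGaussianRadon μ R) : MemLp id 2 μ := by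
  obtain ⟨F, hF, hs, μ₀, hμ₀, rfl⟩ := h.exists_separable
  have := hF.completeSpace_coe
  have hsc : SecondCountableTopology F := UniformSpace.secondCountable_of_separable F
  have hemb : MeasurableEmbedding (F.subtypeL : F → E) := .subtype_coe hF.measurableSet
  rw [hemb.memLp_map_measure_iff]
  exact F.subtypeL.comp_memLp' (IsGaussian.memLp_two_id (μ := μ₀))

end Support

section Compact

variable {E : Type*} [NormedAddCommGroup E] [NormedSpace ℝ E] [CompleteSpace E]

open scoped ENNReal

/-- The operator `g ↦ ∫ g f dP` from `L²(P)` to `E` attached to `f ∈ L²(P; E)`. -/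
noncomputable def integralSMul {Ω : Type*} [MeasurableSpace Ω] (P : Measure Ω) :
    Lp E 2 P →L[ℝ] Lp ℝ 2 P →L[ℝ] E :=
  (ContinuousLinearMap.lsmul ℝ ℝ : ℝ →L[ℝ] E →L[ℝ] E).flip.lpPairing P 2 2

theorem integralSMul_apply {Ω : Type*} [MeasurableSpace Ω] (P : Measure Ω)
    (f : Lp E 2 P) (g : Lp ℝ 2 P) : integralSMul P f g = ∫ ω, g ω • f ω ∂P := by
  unfold integralSMul
  rw [ContinuousLinearMap.lpPairing_eq_integral]
  rfl

/-- For a simple function `f` the operator has finite rank, and simple functions are dense in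
`L²(P; E)`. -/
theorem isCompactOperator_integralSMul {Ω : Type*} [MeasurableSpace Ω] (P : Measure Ω)
    (f : Lp E 2 P) : IsCompactOperator (integralSMul P f) := by
  induction f using Lp.induction (by simp : (2 : ℝ≥0∞) ≠ ∞) with
  | @indicatorConst c s hs hμs =>
    -- for `f = 1_s c` the operator has rank one
    let ℓ : Lp ℝ 2 P →L[ℝ] ℝ := integralSMul P (indicatorConstLp 2 hs hμs.ne (1 : ℝ))
    have h1 : ((integralSMul P (Lp.simpleFunc.indicatorConst 2 hs hμs.ne c :
        Lp E 2 P) : Lp ℝ 2 P →L[ℝ] E) : Lp ℝ 2 P → E)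
        = (ContinuousLinearMap.toSpanSingleton ℝ c) ∘ ℓ := by
      ext g
      simp only [Function.comp_apply, ContinuousLinearMap.toSpanSingleton_apply, ℓ,
        integralSMul_apply, Lp.simpleFunc.coe_indicatorConst]
      rw [← integral_smul_const]
      refine integral_congr_ae ?_
      filter_upwards [indicatorConstLp_coeFn (p := 2) (hs := hs) (hμs := hμs.ne) (c := c),
        indicatorConstLp_coeFn (p := 2) (hs := hs) (hμs := hμs.ne) (c := (1 : ℝ))] with ω h1 h2
      rw [h1, h2]
      by_cases hω : ω ∈ s <;> simp [hω]
    rw [h1]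
    have h2 : IsCompactOperator (ContinuousLinearMap.toSpanSingleton ℝ c) :=
      isCompactOperator_of_locallyCompactSpace_rng _
    exact h2.comp_clm ℓ
  | add hf hg hdisj ihf ihg =>
    rw [map_add]
    exact ihf.add ihg
  | isClosed =>
    exact isClosed_setOfPred_isCompactOperator.preimage (integralSMul P).continuous

/-- The embedding of the reproducing kernel Hilbert space of a Gaussian Radon measure is compact:
`Q x* = ∫ ⟨z, x*⟩ z dμ(z)`, and `g ↦ ∫ g(z) z dμ(z)` is a compact operator on `L²(μ)`. -/
theorem IsCenteredGaussianRadon.isCompactOperator_embed [MeasurableSpace E] [BorelSpace E]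
    {μ : Measure E} {R : StrongDual ℝ E →L[ℝ] E} (h : IsCenteredGaussianRadon μ R) :
    IsCompactOperator (RKHSpace.embed h.isPosSymm) := by
  have := h.isGaussian
  have hid := h.memLp_id
  have hdual : ∀ x : StrongDual ℝ E, MemLp x 2 μ := fun x => IsGaussian.memLp_dual μ x 2 (by simp)
  have hint : ∀ x : StrongDual ℝ E, integralSMul μ hid.toLp (hdual x).toLp = R x := fun x => by
    have h1 : integralSMul μ hid.toLp (hdual x).toLp = ∫ z, x z • z ∂μ := by
      rw [integralSMul_apply]
      refine integral_congr_ae ?_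
      filter_upwards [hid.coeFn_toLp, (hdual x).coeFn_toLp] with z h1 h2
      rw [h1, h2, id]
    have h2 : Integrable (fun z => x z • z) μ :=
      memLp_one_iff_integrable.1 (hid.smul (hdual x))
    rw [h1]
    refine (SeparatingDual.eq_iff_forall_dual_eq (R := ℝ)).2 fun y => ?_
    rw [← y.integral_comp_comm h2, ← h.covariance x y]
    simp only [map_smul, smul_eq_mul]
  have hnorm : ∀ x : StrongDual ℝ E, ‖(hdual x).toLp‖ = ‖RangeSpace.mk h.isPosSymm x‖ :=
    fun x => by
    rw [← sq_eq_sq₀ (norm_nonneg _) (norm_nonneg _), RangeSpace.norm_mk_sq,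
      ← real_inner_self_eq_norm_sq, L2.inner_def, ← h.covariance]
    refine integral_congr_ae ?_
    filter_upwards [(hdual x).coeFn_toLp] with z hz
    rw [hz]
    rfl
  have hcpt := (isCompactOperator_integralSMul μ hid.toLp).isCompact_closure_image_ball
    (f := (integralSMul μ hid.toLp : Lp ℝ 2 μ →ₗ[ℝ] E)) 1
  refine (isCompactOperator_iff_isCompact_closure_image_ball
    (RKHSpace.embed h.isPosSymm : RKHSpace h.isPosSymm →ₗ[ℝ] E) one_pos).2 ?_
  refine hcpt.of_isClosed_subset isClosed_closure (closure_minimal ?_ isClosed_closure)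
  -- by density, it is enough to treat the elements of the open unit ball in the range of `R`
  have hdense : Metric.ball (0 : RKHSpace h.isPosSymm) 1 ⊆ closure
      (Metric.ball 0 1 ∩ range ((↑) : RangeSpace h.isPosSymm → RKHSpace h.isPosSymm)) :=
    Dense.open_subset_closure_inter UniformSpace.Completion.denseRange_coe Metric.isOpen_ball
  rintro _ ⟨g, hg, rfl⟩
  refine closure_mono ?_ (image_closure_subset_closure_image
    (RKHSpace.embed h.isPosSymm).continuous (mem_image_of_mem _ (hdense hg)))
  rintro _ ⟨_, ⟨hu1, u, rfl⟩, rfl⟩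
  obtain ⟨x, rfl⟩ := RangeSpace.mk_surjective h.isPosSymm u
  refine ⟨(hdual x).toLp, ?_, ?_⟩
  · rw [mem_ball_zero_iff] at hu1 ⊢
    rwa [hnorm, ← UniformSpace.Completion.norm_coe]
  · rw [RKHSpace.embed_coe, RangeSpace.incl_mk]
    exact hint x

end Compact

/-! ### Isonormal Gaussian processes -/

section Isonormal

open Complex in
theorem integral_exp_sum_infinitePi_gaussianReal {ι : Type*} (s : Finset ι) (c : ι → ℝ) :
    ∫ ω, cexp ((∑ i ∈ s, c i * ω i : ℝ) * I)
      ∂(Measure.infinitePi fun _ : ι => gaussianReal 0 1) =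
      cexp (-(∑ i ∈ s, c i ^ 2 : ℝ) / 2) := by
  have h1 := integral_restrict_infinitePi (μ := fun _ : ι => gaussianReal 0 1) (s := s)
    (f := fun ω : s → ℝ => ∏ i : s, cexp ((c i * ω i : ℝ) * I))
    (Continuous.aestronglyMeasurable (by fun_prop))
  have h2 : ∀ ω : ι → ℝ, cexp ((∑ i ∈ s, c i * ω i : ℝ) * I)
      = ∏ i : s, cexp ((c i * s.restrict ω i : ℝ) * I) := fun ω => by
    rw [← exp_sum, ← Finset.sum_mul, ofReal_sum, ← Finset.sum_coe_sort s]
    rfl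
  simp_rw [h2, h1]
  rw [integral_fintype_prod_eq_prod (f := fun (i : s) (x : ℝ) => cexp ((c i * x : ℝ) * I))]
  have h3 : ∀ a : ℝ, ∫ x, cexp ((a * x : ℝ) * I) ∂(gaussianReal 0 1) = cexp (-(a ^ 2 : ℝ) / 2) :=
    fun a => by
    have h4 := charFun_gaussianReal (μ := 0) (v := 1) a
    rw [charFun_apply_real] at h4
    simp only [ofReal_mul, h4]
    congr 1
    simp
    ring
  simp_rw [h3]
  rw [← exp_sum, ← Finset.sum_coe_sort s, ofReal_sum, ← Finset.sum_div, Finset.sum_neg_distrib]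

theorem norm_exp_mul_I_sub_le (a b : ℝ) :
    ‖Complex.exp (a * Complex.I) - Complex.exp (b * Complex.I)‖ ≤ |a - b| := by
  have h1 : Complex.exp (a * Complex.I) - Complex.exp (b * Complex.I)
      = Complex.exp (b * Complex.I) * (Complex.exp (Complex.I * (a - b : ℝ)) - 1) := by
    rw [mul_sub, ← Complex.exp_add, mul_one]
    congr 2
    push_cast
    ring
  rw [h1, norm_mul, Complex.norm_exp_ofReal_mul_I, one_mul]
  exact Real.norm_exp_I_mul_ofReal_sub_one_le

theorem integral_abs_le_norm_Lp_two {Ω : Type*} [MeasurableSpace Ω] {P : Measure Ω}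
    [IsProbabilityMeasure P] (f : Lp ℝ 2 P) : ∫ ω, |f ω| ∂P ≤ ‖f‖ := by
  have h1 := eLpNorm_le_eLpNorm_of_exponent_le (p := 1) (q := 2) (μ := P) (by norm_num)
    (Lp.aestronglyMeasurable f)
  rw [Lp.norm_def]
  simp_rw [← Real.norm_eq_abs]
  rw [integral_norm_eq_lintegral_enorm (Lp.aestronglyMeasurable f),
    ← eLpNorm_one_eq_lintegral_enorm]
  exact ENNReal.toReal_mono (Lp.eLpNorm_ne_top f) h1

theorem integrable_exp_mul_I {Ω : Type*} [MeasurableSpace Ω] {P : Measure Ω}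
    [IsFiniteMeasure P] {f : Ω → ℝ} (hf : AEStronglyMeasurable f P) :
    Integrable (fun ω => Complex.exp (f ω * Complex.I)) P := by
  refine Integrable.of_bound (C := 1) ?_ (ae_of_all _ fun ω => ?_)
  · exact (Complex.continuous_exp.comp (Complex.continuous_ofReal.mul
      continuous_const)).comp_aestronglyMeasurable hf
  · rw [Complex.norm_exp_ofReal_mul_I]

theorem continuous_integral_exp_mul_I {Ω : Type*} [MeasurableSpace Ω] (P : Measure Ω)
    [IsProbabilityMeasure P] :
    Continuous fun f : Lp ℝ 2 P => ∫ ω, Complex.exp (f ω * Complex.I) ∂P := by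
  refine LipschitzWith.continuous (K := 1) (LipschitzWith.of_dist_le_mul fun f g => ?_)
  rw [NNReal.coe_one, one_mul, dist_eq_norm, dist_eq_norm,
    ← integral_sub (integrable_exp_mul_I (Lp.aestronglyMeasurable f))
      (integrable_exp_mul_I (Lp.aestronglyMeasurable g))]
  refine (norm_integral_le_integral_norm _).trans
    (le_trans ?_ (integral_abs_le_norm_Lp_two (f - g)))
  have hi : Integrable (fun ω => |(f - g) ω|) P :=
    ((Lp.memLp (f - g)).integrable (by norm_num)).abs
  refine integral_mono_of_nonneg (ae_of_all _ fun _ => norm_nonneg _) hi ?_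
  filter_upwards [Lp.coeFn_sub f g] with ω hω
  rw [hω]
  exact norm_exp_mul_I_sub_le _ _

/-- Every real Hilbert space carries an isonormal Gaussian process: an isometric embedding into
some `L²(P)` whose values are centered Gaussian. It sends an orthonormal basis to independent
standard Gaussian coordinates. -/
theorem exists_isonormal.{u} (H : Type u) [NormedAddCommGroup H] [InnerProductSpace ℝ H]
    [CompleteSpace H] :
    ∃ (Ω : Type u) (_ : MeasurableSpace Ω) (P : Measure Ω) (_ : IsProbabilityMeasure P)
      (W : H →ₗᵢ[ℝ] Lp ℝ 2 P), ∀ h : H,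
        ∫ ω, Complex.exp (W h ω * Complex.I) ∂P = Complex.exp (-(‖h‖ ^ 2 : ℝ) / 2) := by
  classical
  obtain ⟨ι, b, -⟩ := exists_hilbertBasis ℝ H
  let P : Measure (ι → ℝ) := Measure.infinitePi fun _ => gaussianReal 0 1
  have hmp : ∀ i, MeasurePreserving (Function.eval i) P (gaussianReal 0 1) :=
    measurePreserving_eval_infinitePi _
  have hξ : ∀ i, MemLp (fun ω : ι → ℝ => ω i) 2 P := fun i =>
    (IsGaussian.memLp_two_id (μ := gaussianReal 0 1)).comp_measurePreserving (hmp i)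
  have hinner : ∀ i j, inner ℝ (hξ i).toLp (hξ j).toLp = ∫ ω, ω i * ω j ∂P := fun i j => by
    rw [L2.inner_def]
    refine integral_congr_ae ?_
    filter_upwards [(hξ i).coeFn_toLp, (hξ j).coeFn_toLp] with ω h1 h2
    rw [h1, h2]
    simp [mul_comm]
  have hmean : ∀ i, ∫ ω, ω i ∂P = 0 := fun i => by
    have h1 := integral_map (μ := P) (hmp i).measurable.aemeasurable (f := id)
      aestronglyMeasurable_id
    rw [(hmp i).map_eq] at h1
    exact h1.symm.trans integral_id_gaussianReal
  have horth : Orthonormal ℝ fun i => (hξ i).toLp := by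
    rw [orthonormal_iff_ite]
    intro i j
    rw [hinner]
    split_ifs with hij
    · subst hij
      have h1 := integral_map (μ := P) (hmp i).measurable.aemeasurable (f := fun x : ℝ => x * x)
        (by fun_prop)
      have h2 := variance_of_integral_eq_zero (X := id) (μ := gaussianReal 0 1) aemeasurable_id
        integral_id_gaussianReal
      rw [variance_id_gaussianReal] at h2
      rw [(hmp i).map_eq] at h1
      refine h1.symm.trans (Eq.trans ?_ h2.symm)
      simp [sq]
    · have hind : IndepFun (fun ω : ι → ℝ => ω i) (fun ω => ω j) P :=
        (iIndepFun_infinitePi (X := fun _ => id) fun _ => measurable_id).indepFun hij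
      rw [hind.integral_fun_mul_eq_mul_integral (hξ i).1 (hξ j).1, hmean, zero_mul]
  let W : H →ₗᵢ[ℝ] Lp ℝ 2 P := horth.orthogonalFamily.linearIsometry.comp
    b.repr.toLinearIsometry
  have hWb : ∀ i, W (b i) = (hξ i).toLp := fun i => by
    change horth.orthogonalFamily.linearIsometry (b.repr (b i)) = _
    rw [b.repr_self, OrthogonalFamily.linearIsometry_apply_single]
    simp
  refine ⟨ι → ℝ, inferInstance, P, inferInstance, W, fun h => ?_⟩
  -- both sides are continuous in `h`, so finite linear combinations of the basis suffice
  have hclosed : IsClosed {h : H | ∫ ω, Complex.exp (W h ω * Complex.I) ∂P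
      = Complex.exp (-(‖h‖ ^ 2 : ℝ) / 2)} :=
    isClosed_eq ((continuous_integral_exp_mul_I P).comp W.continuous) (by fun_prop)
  have hmem : h ∈ (Submodule.span ℝ (range b)).topologicalClosure := by
    rw [b.dense_span]; trivial
  refine closure_minimal (fun g hg => ?_) hclosed hmem
  obtain ⟨c, rfl⟩ := Finsupp.mem_span_range_iff_exists_finsupp.1 hg
  have hW : W (c.sum fun i a => a • b i) =ᵐ[P] fun ω => ∑ i ∈ c.support, c i * ω i := by
    rw [Finsupp.sum]
    generalize c.support = s
    induction s using Finset.induction_on with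
    | empty =>
      simp only [Finset.sum_empty, map_zero]
      exact Lp.coeFn_zero ℝ 2 P
    | insert i s hi ih =>
      simp only [Finset.sum_insert hi, map_add, map_smul, hWb]
      filter_upwards [ih, Lp.coeFn_add (c i • (hξ i).toLp) (W (∑ j ∈ s, c j • b j)),
        Lp.coeFn_smul (c i) (hξ i).toLp, (hξ i).coeFn_toLp] with ω h1 h2 h3 h4
      rw [h2, Pi.add_apply, h1, h3, Pi.smul_apply, h4, smul_eq_mul]
  have hnorm : ‖c.sum fun i a => a • b i‖ ^ 2 = ∑ i ∈ c.support, c i ^ 2 := by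
    rw [← real_inner_self_eq_norm_sq, Finsupp.sum,
      b.orthonormal.inner_sum]
    simp [sq]
  rw [mem_ofPred_eq, hnorm, ← integral_exp_sum_infinitePi_gaussianReal]
  refine integral_congr_ae ?_
  filter_upwards [hW] with ω hω
  rw [hω]

end Isonormal

/-! ### Cylindrical random variables with Radon law -/

section Representation

variable {E : Type*} [NormedAddCommGroup E] [NormedSpace ℝ E]

/-- Functionals norming a dense sequence of a separable subspace separate its points. -/
theorem exists_separating_seq (F : Submodule ℝ E) [TopologicalSpace.SeparableSpace F] :
    ∃ u : ℕ → StrongDual ℝ E, ∀ z : F, (∀ n, u n z = 0) → z = 0 := by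
  choose y hy1 hy2 using fun v : E => exists_dual_vector'' ℝ v
  refine ⟨fun n => y (TopologicalSpace.denseSeq F n), fun z hz => ?_⟩
  by_contra hne
  have hpos : 0 < ‖z‖ := norm_pos_iff.2 hne
  obtain ⟨n, hn⟩ := (TopologicalSpace.denseRange_denseSeq F).exists_dist_lt z (half_pos hpos)
  set w := TopologicalSpace.denseSeq F n with hw
  have h1 : ‖(w : E)‖ ≤ ‖z - w‖ := by
    have h2 : y w (w - z) = ‖(w : E)‖ := by
      rw [map_sub, hz n, sub_zero]; exact hy2 w
    rw [← h2, norm_sub_rev]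
    refine (le_abs_self _).trans (((y w).le_opNorm _).trans ?_)
    exact mul_le_of_le_one_left (norm_nonneg _) (hy1 w)
  rw [dist_eq_norm] at hn
  have h3 : ‖z‖ ≤ ‖z - w‖ + ‖w‖ := by simpa using norm_add_le (z - w) w
  have h4 : ‖w‖ = ‖(w : E)‖ := rfl
  linarith

variable [MeasurableSpace E]

/-- A family `W` of real random variables indexed by `E*` that is almost surely linear and has the
characteristic functional of `μ`: a cylindrical random variable with law `μ`. -/
structure IsCylindrical {Ω : Type*} [MeasurableSpace Ω] (P : Measure Ω)
    (W : StrongDual ℝ E → Ω → ℝ) (μ : Measure E) : Prop where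
  measurable : ∀ x, Measurable (W x)
  add : ∀ x y, W (x + y) =ᵐ[P] W x + W y
  smul : ∀ (c : ℝ) x, W (c • x) =ᵐ[P] c • W x
  charFun : ∀ x, ∫ ω, Complex.exp (W x ω * Complex.I) ∂P = charFunDual μ x

variable {Ω : Type*} [MeasurableSpace Ω] {P : Measure Ω} {W : StrongDual ℝ E → Ω → ℝ}
  {μ : Measure E}

theorem IsCylindrical.sum (hW : IsCylindrical P W μ) {ι : Type*} (s : Finset ι) (c : ι → ℝ)
    (u : ι → StrongDual ℝ E) :
    W (∑ i ∈ s, c i • u i) =ᵐ[P] fun ω => ∑ i ∈ s, c i * W (u i) ω := by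
  classical
  induction s using Finset.induction_on with
  | empty =>
    have h := hW.smul 0 0
    simp only [zero_smul] at h
    simp only [Finset.sum_empty]
    exact h
  | insert i s hi ih =>
    simp only [Finset.sum_insert hi]
    filter_upwards [ih, hW.add (c i • u i) (∑ j ∈ s, c j • u j), hW.smul (c i) (u i)]
      with ω h1 h2 h3
    rw [h2, Pi.add_apply, h1, h3, Pi.smul_apply, smul_eq_mul]

variable [BorelSpace E] [IsProbabilityMeasure P] [IsProbabilityMeasure μ]

/-- Countably many values of a cylindrical random variable have the same joint law as the
corresponding functionals under `μ`: the finite-dimensional distributions are determined by their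
characteristic functions. -/
theorem IsCylindrical.map_eq (hW : IsCylindrical P W μ) (u : ℕ → StrongDual ℝ E) :
    P.map (fun ω n => W (u n) ω) = μ.map (fun z n => u n z) := by
  have hm1 : Measurable fun ω n => W (u n) ω := measurable_pi_lambda _ fun n => hW.measurable _
  have hm2 : Measurable fun (z : E) n => u n z :=
    measurable_pi_lambda _ fun n => (u n).continuous.measurable
  have := Measure.isProbabilityMeasure_map (μ := P) hm1.aemeasurable
  have := Measure.isProbabilityMeasure_map (μ := μ) hm2.aemeasurable
  have hlim : IsProjectiveLimit (P.map fun ω n => W (u n) ω)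
      fun I : Finset ℕ => (P.map fun ω n => W (u n) ω).map I.restrict := fun I => rfl
  refine hlim.unique fun I => ?_
  change _ = (P.map fun ω n => W (u n) ω).map I.restrict
  have hr : Measurable (I.restrict : (ℕ → ℝ) → (I → ℝ)) := Finset.measurable_restrict I
  rw [Measure.map_map hr hm2, Measure.map_map hr hm1]
  have := Measure.isProbabilityMeasure_map (μ := P) (hr.comp hm1).aemeasurable
  have := Measure.isProbabilityMeasure_map (μ := μ) (hr.comp hm2).aemeasurable
  refine Measure.ext_of_charFunDual ?_
  ext L
  let c : I → ℝ := fun i => L fun j => if i = j then 1 else 0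
  have hL : ∀ v : I → ℝ, L v = ∑ i : I, c i * v i := fun v => by
    refine ((L : (I → ℝ) →ₗ[ℝ] ℝ).pi_apply_eq_sum_univ v).trans ?_
    simp only [c, smul_eq_mul, mul_comm, ContinuousLinearMap.coe_coe]
  have hx := hW.charFun (∑ i : I, c i • u i)
  rw [charFunDual_apply] at hx ⊢
  rw [charFunDual_apply, integral_map (hr.comp hm2).aemeasurable (by fun_prop),
    integral_map (hr.comp hm1).aemeasurable (by fun_prop)]
  refine Eq.trans ?_ (hx.symm.trans ?_)
  · refine integral_congr_ae (ae_of_all _ fun z => ?_)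
    simp [hL]
  · refine integral_congr_ae ?_
    filter_upwards [hW.sum Finset.univ c (fun i => u i)] with ω hω
    rw [hω, hL]
    rfl

/-- A cylindrical random variable whose law is carried by a closed separable subspace `F` is
induced by an `F`-valued random variable: a separating sequence of functionals embeds `F` into
`ℝ^ℕ`, and this embedding has a measurable left inverse by the Lusin–Souslin theorem. -/
theorem IsCylindrical.exists_random_variable [CompleteSpace E] {F : Submodule ℝ E}
    (hF : IsClosed (F : Set E)) [TopologicalSpace.SeparableSpace F] {μ₀ : Measure F}
    [IsProbabilityMeasure μ₀]
    (hW : IsCylindrical P W (μ₀.map F.subtypeL)) :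
    ∃ X : Ω → F, Measurable X ∧ (∀ x : StrongDual ℝ E, (fun ω => x (X ω)) =ᵐ[P] W x) ∧
      P.map X = μ₀ := by
  have := hF.completeSpace_coe
  have hsc : SecondCountableTopology F := UniformSpace.secondCountable_of_separable F
  have := Measure.isProbabilityMeasure_map (μ := μ₀) F.subtypeL.continuous.measurable.aemeasurable
  obtain ⟨u, hu⟩ := exists_separating_seq F
  have hJc : Continuous fun (z : F) (n : ℕ) => u n z :=
    continuous_pi fun n => (u n).continuous.comp continuous_subtype_val
  have hJi : Function.Injective fun (z : F) (n : ℕ) => u n z := fun z w hzw =>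
    sub_eq_zero.1 (hu _ fun n => by
      have h := congrFun hzw n
      simpa [sub_eq_zero] using h)
  obtain ⟨G, hG, hGJ⟩ := (hJc.measurableEmbedding hJi).exists_measurable_extend
    (measurable_id (α := F)) fun _ => ⟨0⟩
  have hGJ' : ∀ z : F, G (fun n => u n z) = z := fun z => congrFun hGJ z
  have hmW : ∀ v : ℕ → StrongDual ℝ E, Measurable fun ω n => W (v n) ω := fun v =>
    measurable_pi_lambda _ fun n => hW.measurable _
  have hmE : ∀ v : ℕ → StrongDual ℝ E, Measurable fun (z : E) n => v n z := fun v =>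
    measurable_pi_lambda _ fun n => (v n).continuous.measurable
  have hi : Measurable (F.subtypeL : F → E) := F.subtypeL.continuous.measurable
  refine ⟨fun ω => G fun n => W (u n) ω, hG.comp (hmW u), fun x => ?_, ?_⟩
  · -- adjoin `x` to the sequence: `x = x ∘ G ∘ (u n)` on `F`, an identity of joint laws
    let v : ℕ → StrongDual ℝ E := fun n => Nat.casesOn n x u
    have hA : MeasurableSet {a : ℕ → ℝ | x (G fun n => a (n + 1)) = a 0} := by
      refine measurableSet_eq_fun ?_ (measurable_pi_apply 0)
      exact (x.continuous.comp continuous_subtype_val).measurable.comp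
        (hG.comp (measurable_pi_lambda _ fun n => measurable_pi_apply _))
    have h1 : ∀ᵐ a ∂(P.map fun ω n => W (v n) ω), x (G fun n => a (n + 1)) = a 0 := by
      rw [hW.map_eq v]
      refine (ae_map_iff (hmE v).aemeasurable hA).2 ((ae_map_iff hi.aemeasurable (hmE v hA)).2 ?_)
      exact ae_of_all _ fun z => congrArg (fun w : F => x w) (hGJ' z)
    exact (ae_map_iff (hmW v).aemeasurable hA).1 h1
  · have h1 : (fun ω => G fun n => W (u n) ω) = G ∘ fun ω n => W (u n) ω := rfl
    rw [h1, ← Measure.map_map hG (hmW u), hW.map_eq u, Measure.map_map hG (hmE u),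
      Measure.map_map (hG.comp (hmE u)) hi]
    have h2 : (G ∘ fun (z : E) (n : ℕ) => u n z) ∘ F.subtypeL = id := funext hGJ'
    rw [h2, Measure.map_id]

end Representation

/-! ### Domination of Gaussian covariances -/

section Domination

variable {E : Type*} [NormedAddCommGroup E] [NormedSpace ℝ E] [MeasurableSpace E] [BorelSpace E]

theorem IsCenteredGaussianRadon.charFunDual_eq {μ : Measure E} {R : StrongDual ℝ E → E}
    (h : IsCenteredGaussianRadon μ R) (x : StrongDual ℝ E) :
    charFunDual μ x = Complex.exp (-(x (R x) : ℝ) / 2) := by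
  have := h.isGaussian
  have hv : Var[x; μ] = x (R x) := by
    rw [variance_of_integral_eq_zero x.continuous.aemeasurable (h.centered x), ← h.covariance]
    simp only [sq]
  rw [IsGaussian.charFunDual_eq_of_forall_strongDual_eq_zero h.centered, hv]

variable [CompleteSpace E]

/-- A symmetric operator dominated by a Gaussian covariance operator is a Gaussian covariance
operator, provided that the difference is the covariance of some centered Gaussian measure `ν`.
With `W₁` an isonormal process for `Q₁` and `Z` independent of law `ν`, the cylindrical random
variable `W₁ + Z` is induced by a random variable `X`, and the conditional expectation of `X` given
`W₁` induces `W₁`. -/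
theorem exists_isCenteredGaussianRadon_of_add {μ ν : Measure E}
    {R Q₁ : StrongDual ℝ E →L[ℝ] E} (hμ : IsCenteredGaussianRadon μ R) (hQ₁ : IsPosSymm Q₁)
    [IsProbabilityMeasure ν] (hν0 : ∀ x : StrongDual ℝ E, ∫ z, x z ∂ν = 0)
    (hνi : ∀ x : StrongDual ℝ E, Integrable x ν)
    (hν : ∀ x : StrongDual ℝ E,
      charFunDual ν x = Complex.exp (-(x (R x) - x (Q₁ x) : ℝ) / 2)) :
    ∃ μ₁ : Measure E, IsCenteredGaussianRadon μ₁ Q₁ := by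
  obtain ⟨F, hF, hs, μ₀, hμ₀, rfl⟩ := hμ.exists_separable
  have := hF.completeSpace_coe
  have hsc : SecondCountableTopology F := UniformSpace.secondCountable_of_separable F
  obtain ⟨Ω, mΩ, P, hP, W₁, hW₁⟩ := exists_isonormal (RKHSpace hQ₁)
  let w : StrongDual ℝ E → Lp ℝ 2 P := fun x => W₁ (RangeSpace.mk hQ₁ x : RKHSpace hQ₁)
  have hw_add : ∀ x y, w (x + y) = w x + w y := fun x y => by
    simp only [w, map_add, UniformSpace.Completion.coe_add]
  have hw_smul : ∀ (c : ℝ) x, w (c • x) = c • w x := fun c x => by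
    simp only [w, map_smul, UniformSpace.Completion.coe_smul]
  have hw_inner : ∀ x y, inner ℝ (w x) (w y) = y (Q₁ x) := fun x y => by
    simp only [w, LinearIsometry.inner_map_map, RKHSpace.inner_mk, RKHSpace.embed_coe,
      RangeSpace.incl_mk]
  have hw_char : ∀ x, ∫ ω, Complex.exp (w x ω * Complex.I) ∂P
      = Complex.exp (-(x (Q₁ x) : ℝ) / 2) := fun x => by
    rw [hW₁, UniformSpace.Completion.norm_coe, RangeSpace.norm_mk_sq]
  have hcyl : IsCylindrical (P.prod ν) (fun (x : StrongDual ℝ E) (p : Ω × E) => w x p.1 + x p.2)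
      (μ₀.map F.subtypeL) :=
    { measurable := fun x => ((Lp.stronglyMeasurable (w x)).measurable.comp measurable_fst).add
        (x.continuous.measurable.comp measurable_snd)
      add := fun x y => by
        have h1 := Measure.quasiMeasurePreserving_fst (μ := P) (ν := ν) |>.ae
          (Lp.coeFn_add (w x) (w y))
        filter_upwards [h1] with p hp
        simp only [hw_add, Pi.add_apply, add_apply] at hp ⊢
        rw [hp]
        ring
      smul := fun c x => by
        have h1 := Measure.quasiMeasurePreserving_fst (μ := P) (ν := ν) |>.ae
          (Lp.coeFn_smul c (w x))
        filter_upwards [h1] with p hp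
        simp only [hw_smul, Pi.smul_apply, smul_apply, smul_eq_mul] at hp ⊢
        rw [hp]
        ring
      charFun := fun x => by
        have h1 : ∀ p : Ω × E, Complex.exp ((w x p.1 + x p.2 : ℝ) * Complex.I)
            = Complex.exp (w x p.1 * Complex.I) * Complex.exp (x p.2 * Complex.I) := fun p => by
          rw [← Complex.exp_add]; push_cast; ring_nf
        simp_rw [h1]
        rw [integral_prod_mul (fun ω => Complex.exp (w x ω * Complex.I))
          (fun z => Complex.exp (x z * Complex.I)), hw_char, ← charFunDual_apply, hν,
          hμ.charFunDual_eq, ← Complex.exp_add]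
        congr 1
        push_cast
        ring }
  obtain ⟨X, hXm, hXW, hXlaw⟩ := hcyl.exists_random_variable hF
  have hXi : Integrable X (P.prod ν) := by
    have h1 : Integrable (id : F → F) ((P.prod ν).map X) := by
      rw [hXlaw]; exact IsGaussian.integrable_id
    exact (integrable_map_measure h1.1 hXm.aemeasurable).1 h1
  -- the conditional expectation of `X` given the first coordinate
  let Y : Ω → F := fun ω => ∫ z, X (ω, z) ∂ν
  have hYm : Measurable Y :=
    (StronglyMeasurable.integral_prod_right (f := fun ω z => X (ω, z)) (ν := ν)
      hXm.stronglyMeasurable).measurable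
  have hY : ∀ x : StrongDual ℝ E, (fun ω => x (Y ω)) =ᵐ[P] w x := fun x => by
    filter_upwards [hXi.prod_right_ae, Measure.ae_ae_of_ae_prod (hXW x)] with ω h1 h2
    have h3 : x (Y ω) = ∫ z, x (X (ω, z)) ∂ν :=
      ((x.comp F.subtypeL).integral_comp_comm h1).symm
    rw [h3, integral_congr_ae h2, integral_add (integrable_const _) (hνi x), hν0]
    simp
  let i : Ω → E := fun ω => Y ω
  have him : Measurable i := F.subtypeL.continuous.measurable.comp hYm
  have hchar : ∀ x, charFunDual (P.map i) x = Complex.exp (-(x (Q₁ x) : ℝ) / 2) := fun x => by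
    rw [charFunDual_apply, integral_map him.aemeasurable (by fun_prop), ← hw_char]
    refine integral_congr_ae ?_
    filter_upwards [hY x] with ω hω
    rw [← hω]
  have := Measure.isProbabilityMeasure_map (μ := P) him.aemeasurable
  have hgauss : ∀ x : StrongDual ℝ E, (P.map i).map x = gaussianReal 0 (x (Q₁ x)).toNNReal := by
    intro x
    have := Measure.isProbabilityMeasure_map (μ := P.map i) x.continuous.measurable.aemeasurable
    refine Measure.ext_of_charFun ?_
    ext t
    rw [charFun_map_eq_charFunDual_smul, hchar, charFun_gaussianReal,
      Real.coe_toNNReal _ (hQ₁.nonneg x)]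
    congr 1
    simp only [map_smul, smul_apply, smul_eq_mul]
    push_cast
    ring
  refine ⟨P.map i, isGaussian_of_map_eq_gaussianReal fun x => ⟨0, _, hgauss x⟩, ?_, ?_, ?_⟩
  · have h1 : P.map i = (P.map Y).map F.subtypeL :=
      (Measure.map_map F.subtypeL.continuous.measurable hYm).symm
    have := Measure.isProbabilityMeasure_map (μ := P) hYm.aemeasurable
    have : (P.map Y).InnerRegular := inferInstance
    rw [h1]
    exact Measure.InnerRegular.map_of_continuous F.subtypeL.continuous
  · intro x
    have h1 := integral_map (μ := P.map i) x.continuous.measurable.aemeasurable (f := id)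
      aestronglyMeasurable_id
    rw [hgauss] at h1
    exact h1.symm.trans integral_id_gaussianReal
  · intro x y
    rw [integral_map him.aemeasurable (by fun_prop), ← hw_inner, L2.inner_def]
    refine integral_congr_ae ?_
    filter_upwards [hY x, hY y] with ω h1 h2
    simp only [i, h1, h2]
    simp [mul_comm]

end Domination

/-! ### Consequences of the strong Feller property -/

section StrongFeller

variable {E : Type*} [NormedAddCommGroup E] [NormedSpace ℝ E] [MeasurableSpace E]

theorem gaussianMeasure_spec {R : StrongDual ℝ E → E}
    (h : ∃ μ : Measure E, IsCenteredGaussianRadon μ R) :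
    IsCenteredGaussianRadon (gaussianMeasure R) R := by
  unfold gaussianMeasure
  rw [dif_pos h]
  exact h.choose_spec

variable [BorelSpace E]

/-- If `c ↦ μ₁(B - c v)` is continuous at `0` for every Borel set `B`, then `v` lies in the
reproducing kernel Hilbert space of `μ₁`. Otherwise there are functionals `x_n` with
`⟨v, x_n⟩ = 1` and `∑ ‖x_n‖²_{L²(μ₁)} < ∞`, and the Borel set `B = {z : ⟨z, x_n⟩ → 0}` has full
measure whereas `B - c v` does not meet `B` for `c ≠ 0`. -/
theorem exists_bound_of_continuous_translate {μ₁ : Measure E} {R : StrongDual ℝ E → E}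
    (hμ₁ : IsCenteredGaussianRadon μ₁ R) (v : E)
    (hv : ∀ B : Set E, MeasurableSet B →
      ContinuousAt (fun c : ℝ => μ₁.real ((fun z => c • v + z) ⁻¹' B)) 0) :
    ∃ C : ℝ, ∀ x : StrongDual ℝ E, |x v| ≤ C * √(x (R x)) := by
  have := hμ₁.isGaussian
  by_contra! hcon
  have hnn : ∀ x : StrongDual ℝ E, 0 ≤ x (R x) := fun x => by
    rw [← hμ₁.covariance]
    exact integral_nonneg fun z => mul_self_nonneg _
  have hx : ∀ n : ℕ, ∃ x : StrongDual ℝ E, x v = 1 ∧ ∫ z, x z ^ 2 ∂μ₁ ≤ (1 / 2) ^ n := fun n => by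
    obtain ⟨x, hx⟩ := hcon (2 ^ n)
    have hpos : 0 < |x v| := lt_of_le_of_lt (by positivity) hx
    have hne : x v ≠ 0 := abs_pos.1 hpos
    refine ⟨(x v)⁻¹ • x, by simp [hne], ?_⟩
    have h1 : ∫ z, ((x v)⁻¹ • x) z ^ 2 ∂μ₁ = ((x v) ^ 2)⁻¹ * x (R x) := by
      rw [← hμ₁.covariance, ← integral_const_mul]
      congr 1
      ext z
      simp
      ring
    rw [h1]
    have h2 : (2 ^ n) ^ 2 * x (R x) ≤ (x v) ^ 2 := by
      have h3 := pow_le_pow_left₀ (by positivity) hx.le 2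
      rwa [mul_pow, Real.sq_sqrt (hnn x), sq_abs] at h3
    have h4 : (2 : ℝ) ^ n * x (R x) ≤ (2 ^ n) ^ 2 * x (R x) :=
      mul_le_mul_of_nonneg_right (le_self_pow₀ (one_le_pow₀ one_le_two) two_ne_zero) (hnn x)
    rw [inv_mul_le_iff₀ (by positivity), one_div, inv_pow, ← div_eq_mul_inv,
      le_div_iff₀ (by positivity), mul_comm]
    exact h4.trans h2
  choose x hxv hxi using hx
  let B : Set E := {z | Tendsto (fun n => x n z) atTop (𝓝 0)}
  have hBm : MeasurableSet B :=
    measurableSet_tendsto (𝓝 0) fun n => (x n).continuous.measurable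
  have hint : ∀ n, Integrable (fun z => x n z ^ 2) μ₁ := fun n =>
    (IsGaussian.memLp_dual μ₁ (x n) 2 (by simp)).integrable_sq
  have hBfull : ∀ᵐ z ∂μ₁, z ∈ B := by
    have hsum : ∑' n, ∫⁻ z, ENNReal.ofReal (x n z ^ 2) ∂μ₁ ≠ ⊤ := by
      refine ne_top_of_le_ne_top (b := ∑' n : ℕ, ENNReal.ofReal ((1 / 2) ^ n)) ?_ ?_
      · exact (summable_geometric_two).tsum_ofReal_ne_top
      · refine ENNReal.tsum_le_tsum fun n => ?_
        rw [← ofReal_integral_eq_lintegral_ofReal (hint n) (ae_of_all _ fun z => sq_nonneg _)]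
        exact ENNReal.ofReal_le_ofReal (hxi n)
    have hmeas : ∀ n, Measurable fun z => ENNReal.ofReal (x n z ^ 2) := fun n =>
      ((x n).continuous.measurable.pow_const 2).ennreal_ofReal
    rw [← lintegral_tsum fun n => (hmeas n).aemeasurable] at hsum
    filter_upwards [ae_lt_top (Measurable.tsum hmeas) hsum] with z hz
    have h1 := ENNReal.tendsto_atTop_zero_of_tsum_ne_top hz.ne
    have h2 := (ENNReal.tendsto_toReal ENNReal.zero_ne_top).comp h1
    have h3 : Tendsto (fun n => x n z ^ 2) atTop (𝓝 0) := by
      refine h2.congr fun n => ?_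
      simp [ENNReal.toReal_ofReal (sq_nonneg _)]
    have h4 := h3.sqrt
    simp only [Real.sqrt_sq_eq_abs, Real.sqrt_zero] at h4
    exact (tendsto_zero_iff_abs_tendsto_zero _).2 h4
  have hB0 : μ₁.real ((fun z => (0 : ℝ) • v + z) ⁻¹' B) = 1 := by
    have h1 : (fun z => (0 : ℝ) • v + z) ⁻¹' B = B := by simp
    rw [h1, measureReal_def, (prob_compl_eq_zero_iff hBm).1 hBfull, ENNReal.toReal_one]
  have hBc : ∀ c : ℝ, c ≠ 0 → μ₁.real ((fun z => c • v + z) ⁻¹' B) = 0 := fun c hc => by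
    have h1 : μ₁ ((fun z => c • v + z) ⁻¹' B) = 0 := by
      refine measure_mono_null (t := Bᶜ) (fun z hz hzB => ?_) hBfull
      have h2 : Tendsto (fun n => x n (c • v + z) - x n z) atTop (𝓝 0) := by
        simpa using Tendsto.sub hz hzB
      have h3 : ∀ n, x n (c • v + z) - x n z = c := fun n => by simp [hxv]
      simp only [h3] at h2
      exact hc (tendsto_nhds_unique tendsto_const_nhds h2)
    rw [measureReal_def, h1, ENNReal.toReal_zero]
  have h1 := (hv B hBm).tendsto
  rw [hB0] at h1
  have h2 : Tendsto (fun c : ℝ => μ₁.real ((fun z => c • v + z) ⁻¹' B)) (𝓝[≠] 0) (𝓝 0) :=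
    tendsto_const_nhds.congr' (by
      filter_upwards [self_mem_nhdsWithin] with c hc using (hBc c hc).symm)
  exact zero_ne_one (tendsto_nhds_unique h2 (h1.mono_left nhdsWithin_le_nhds))

variable {S : ℝ → E →L[ℝ] E} {Q : StrongDual ℝ E →L[ℝ] E}

theorem transition_indicator (t : ℝ) {B : Set E} (hB : MeasurableSet B) (v : E) :
    transition S Q t (B.indicator fun _ => 1) v =
      ((gaussianMeasure (covOp S Q t)).real ((fun z => S t v + z) ⁻¹' B) : ℂ) := by
  have hm : Measurable fun z : E => S t v + z := measurable_const_add _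
  unfold transition
  have h1 : (fun y => B.indicator (fun _ => (1 : ℂ)) (S t v + y))
      = ((fun z => S t v + z) ⁻¹' B).indicator fun _ => 1 := rfl
  rw [h1, integral_indicator_const _ (hm hB)]
  simp

/-- Under the strong Feller property the range of `S(t)` lies in the reproducing kernel Hilbert
space of `Q_t`; by the uniform boundedness principle `‖S*(t) x*‖² ≤ K² ⟨Q_t x*, x*⟩`. -/
theorem IsStronglyFeller.exists_norm_comp_le [CompleteSpace E] (hP : IsStronglyFeller S Q) {t : ℝ}
    (ht : 0 < t) (hex : ∃ μ : Measure E, IsCenteredGaussianRadon μ (covOp S Q t)) :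
    ∃ K : ℝ, 0 ≤ K ∧ ∀ x : StrongDual ℝ E, ‖x.comp (S t)‖ ≤ K * √(x (covOp S Q t x)) := by
  have hG := gaussianMeasure_spec hex
  have hpoint : ∀ v : E, ∃ C : ℝ, ∀ x : StrongDual ℝ E,
      |x (S t v)| ≤ C * √(x (covOp S Q t x)) := fun v => by
    refine exists_bound_of_continuous_translate hG (S t v) fun B hB => ?_
    have h1 := (hP t ht (B.indicator fun _ => 1) (measurable_const.indicator hB)
      ⟨1, fun z => by
        by_cases hz : z ∈ B <;> simp [hz]⟩).1
    have h2 : Continuous fun c : ℝ => (transition S Q t (B.indicator fun _ => 1) (c • v)).re :=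
      Complex.continuous_re.comp (h1.comp (by fun_prop))
    simp only [transition_indicator t hB, Complex.ofReal_re, map_smul] at h2
    exact h2.continuousAt
  choose C hC using hpoint
  -- normalize the functionals `S*(t) x*`; if `⟨Q_t x*, x*⟩ = 0` then `S*(t) x*` vanishes and so
  -- does its normalization, since `0⁻¹ = 0`
  obtain ⟨K, hK⟩ := banach_steinhaus
    (g := fun x : StrongDual ℝ E => (√(x (covOp S Q t x)))⁻¹ • x.comp (S t)) fun v =>
      ⟨|C v|, fun x => by
        rw [smul_apply, norm_smul, norm_inv, Real.norm_of_nonneg (Real.sqrt_nonneg _)]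
        have h1 : |x (S t v)| ≤ |C v| * √(x (covOp S Q t x)) :=
          (hC v x).trans (mul_le_mul_of_nonneg_right (le_abs_self _) (Real.sqrt_nonneg _))
        exact inv_mul_le_of_le_mul₀ (Real.sqrt_nonneg _) (abs_nonneg _) (by rwa [mul_comm])⟩
  refine ⟨K, (norm_nonneg _).trans (hK 0), fun x => ?_⟩
  rcases eq_or_ne (√(x (covOp S Q t x))) 0 with h0 | h0
  · have h1 : x.comp (S t) = 0 := by
      ext v
      have h2 := hC v x
      rw [h0, mul_zero] at h2
      exact abs_nonpos_iff.1 h2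
    rw [h0, h1, norm_zero, mul_zero]
  · have h1 := hK x
    rw [norm_smul, norm_inv, Real.norm_of_nonneg (Real.sqrt_nonneg _),
      inv_mul_le_iff₀ (lt_of_le_of_ne (Real.sqrt_nonneg _) h0.symm)] at h1
    rwa [mul_comm]

end StrongFeller

/-! ### Restriction of the semigroup to the reproducing kernel Hilbert space -/

section Restriction

variable {E : Type*} [NormedAddCommGroup E] [NormedSpace ℝ E] [CompleteSpace E]
  {R : StrongDual ℝ E →L[ℝ] E}

/-- If `‖A* x*‖ ≤ K (⟨R x*, x*⟩ - ⟨R A* x*, A* x*⟩)^{1/2}`, then `A` maps all of `E` boundedly into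
`H_R`, and it restricts to a strict contraction of `H_R`. The restriction factors through the
embedding of `H_R` into `E`, hence it is compact when the embedding is. -/
theorem exists_restriction_of_norm_comp_le (hR : IsPosSymm R)
    (hcpt : IsCompactOperator (RKHSpace.embed hR)) (A : E →L[ℝ] E) {K : ℝ} (hK : 0 ≤ K)
    (hA : ∀ x : StrongDual ℝ E,
      ‖x.comp A‖ ≤ K * √(x (R x) - x (A (R (x.comp A))))) :
    ∃ T : RKHSpace hR →L[ℝ] RKHSpace hR,
      (∀ h, RKHSpace.embed hR (T h) = A (RKHSpace.embed hR h)) ∧ IsCompactOperator T ∧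
        ‖T‖ < 1 := by
  have hpos : ∀ x : StrongDual ℝ E, 0 ≤ x (A (R (x.comp A))) := fun x => hR.nonneg (x.comp A)
  have hle : ∀ x : StrongDual ℝ E, ‖x.comp A‖ ≤ K * √(x (R x)) := fun x =>
    (hA x).trans (mul_le_mul_of_nonneg_left
      (Real.sqrt_le_sqrt (sub_le_self _ (hpos x))) hK)
  obtain ⟨V, hV, -⟩ := RKHSpace.exists_lift hR A hK fun f x => by
    calc |x (A f)| ≤ ‖x.comp A‖ * ‖f‖ := (x.comp A).le_opNorm f
      _ ≤ K * √(x (R x)) * ‖f‖ := by gcongr; exact hle x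
      _ = K * ‖f‖ * √(x (R x)) := by ring
  let a := ‖R‖ * K ^ 2
  have ha : 0 ≤ a := by positivity
  -- with `q(x) = ⟨R x, x⟩`: `q(A* x) ≤ ‖R‖ ‖A* x‖² ≤ a (q(x) - q(A* x))`
  have hstrict : ∀ x : StrongDual ℝ E,
      x (A (R (x.comp A))) ≤ a / (1 + a) * x (R x) := fun x => by
    have h1 : x (A (R (x.comp A))) ≤ ‖R‖ * ‖x.comp A‖ ^ 2 := by
      calc x (A (R (x.comp A))) ≤ ‖x.comp A‖ * (‖R‖ * ‖x.comp A‖) :=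
            (le_abs_self _).trans ((x.comp A).le_opNorm_of_le (R.le_opNorm _))
        _ = _ := by ring
    have hq : 0 ≤ x (R x) - x (A (R (x.comp A))) := by
      by_contra! hneg
      have h2 := hA x
      rw [Real.sqrt_eq_zero_of_nonpos hneg.le, mul_zero] at h2
      have h3 : ‖x.comp A‖ = 0 := le_antisymm h2 (norm_nonneg _)
      rw [h3] at h1
      have h4 := hR.nonneg x
      nlinarith
    have h2 : ‖x.comp A‖ ^ 2 ≤ K ^ 2 * (x (R x) - x (A (R (x.comp A)))) := by
      have h3 := pow_le_pow_left₀ (norm_nonneg _) (hA x) 2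
      rwa [mul_pow, Real.sq_sqrt hq] at h3
    have h3 : x (A (R (x.comp A))) ≤ a * (x (R x) - x (A (R (x.comp A)))) := by
      refine h1.trans ((mul_le_mul_of_nonneg_left h2 (norm_nonneg R)).trans_eq ?_)
      ring
    rw [div_mul_eq_mul_div, le_div_iff₀ (by positivity)]
    linarith
  obtain ⟨T, hT, hTn⟩ := RKHSpace.exists_lift hR (A.comp (RKHSpace.embed hR))
    (Real.sqrt_nonneg (a / (1 + a))) fun h x => by
      refine (RKHSpace.abs_apply_embed_le hR h (x.comp A)).trans ?_
      rw [mul_comm (√_) ‖h‖, mul_assoc, ← Real.sqrt_mul (by positivity)]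
      exact mul_le_mul_of_nonneg_left (Real.sqrt_le_sqrt (hstrict x)) (norm_nonneg h)
  refine ⟨T, hT, ?_, hTn.trans_lt ?_⟩
  · have h1 : (T : RKHSpace hR → RKHSpace hR) = V ∘ RKHSpace.embed hR := by
      ext h
      exact RKHSpace.embed_injective hR ((hT h).trans (hV _).symm)
    rw [h1]
    exact hcpt.clm_comp V
  · rw [Real.sqrt_lt' one_pos, one_pow, div_lt_one (by positivity)]
    linarith

variable [MeasurableSpace E] [BorelSpace E]
  {S : ℝ → E →L[ℝ] E} {Q Qinf : StrongDual ℝ E →L[ℝ] E}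

/-- `Q_t = Q_∞ - S(t) Q_∞ S*(t)` is a Gaussian covariance operator, being dominated by `Q_∞`; here
`S(t) Q_∞ S*(t)` is the covariance operator of the image of `μ` under `S(t)`. -/
theorem exists_isCenteredGaussianRadon_covOp (hS : IsC0Semigroup S) (hQ : IsPosSymm Q)
    (hQinf : IsWeakLimitCov S Q Qinf) {μ : Measure E} (hμ : IsCenteredGaussianRadon μ Qinf)
    {t : ℝ} (ht : 0 ≤ t) : ∃ μ₁ : Measure E, IsCenteredGaussianRadon μ₁ (covOp S Q t) := by
  have := hμ.isGaussian
  have hm : Measurable (S t) := (S t).continuous.measurable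
  have := Measure.isProbabilityMeasure_map (μ := μ) hm.aemeasurable
  rw [covOp_eq_covCLM hS hQ hQinf ht]
  refine exists_isCenteredGaussianRadon_of_add (ν := μ.map (S t)) hμ
    (isPosSymm_covCLM hS hQ hQinf hμ.isPosSymm ht) (fun x => ?_)
    (fun x => IsGaussian.integrable_dual _ x) fun x => ?_
  · rw [integral_map hm.aemeasurable (by fun_prop)]
    exact hμ.centered (x.comp (S t))
  · rw [charFunDual_map, hμ.charFunDual_eq, covCLM_apply, map_sub, sub_sub_cancel]
    rfl

end Restriction

end OrnsteinUhlenbeck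

theorem mainTheorem9 {E : Type*} [NormedAddCommGroup E] [NormedSpace ℝ E] [CompleteSpace E]
    [MeasurableSpace E] [BorelSpace E]
    (S : ℝ → E →L[ℝ] E) (hS : OrnsteinUhlenbeck.IsC0Semigroup S)
    (Q : StrongDual ℝ E →L[ℝ] E) (hQ : OrnsteinUhlenbeck.IsPosSymm Q)
    (Qinf : StrongDual ℝ E →L[ℝ] E) (hQinf : OrnsteinUhlenbeck.IsWeakLimitCov S Q Qinf)
    (μ : Measure E) (hμ : OrnsteinUhlenbeck.IsCenteredGaussianRadon μ Qinf)
    (hP : OrnsteinUhlenbeck.IsStronglyFeller S Q) :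
    ∃ Sμ : ℝ → OrnsteinUhlenbeck.RKHSpace hμ.isPosSymm →L[ℝ]
        OrnsteinUhlenbeck.RKHSpace hμ.isPosSymm,
      (∀ t : ℝ, 0 ≤ t → ∀ h : OrnsteinUhlenbeck.RKHSpace hμ.isPosSymm,
        OrnsteinUhlenbeck.RKHSpace.embed hμ.isPosSymm (Sμ t h) =
          S t (OrnsteinUhlenbeck.RKHSpace.embed hμ.isPosSymm h)) ∧
      OrnsteinUhlenbeck.IsC0Semigroup Sμ ∧
      OrnsteinUhlenbeck.IsCompactSemigroup Sμ ∧
      OrnsteinUhlenbeck.IsStrictlyContractive Sμ := by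
  have hcpt := hμ.isCompactOperator_embed
  have hpos : ∀ t : ℝ, 0 < t → ∃ T : OrnsteinUhlenbeck.RKHSpace hμ.isPosSymm →L[ℝ]
      OrnsteinUhlenbeck.RKHSpace hμ.isPosSymm,
      (∀ h, OrnsteinUhlenbeck.RKHSpace.embed hμ.isPosSymm (T h) =
        S t (OrnsteinUhlenbeck.RKHSpace.embed hμ.isPosSymm h)) ∧
      IsCompactOperator T ∧ ‖T‖ < 1 := fun t ht => by
    obtain ⟨K, hK0, hK⟩ := hP.exists_norm_comp_le ht
      (OrnsteinUhlenbeck.exists_isCenteredGaussianRadon_covOp hS hQ hQinf hμ ht.le)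
    refine OrnsteinUhlenbeck.exists_restriction_of_norm_comp_le hμ.isPosSymm hcpt (S t) hK0
      fun x => ?_
    rw [← map_sub, ← OrnsteinUhlenbeck.covOp_eq_sub hS hQ hQinf x ht.le]
    exact hK x
  choose T hT hTc hTn using hpos
  let Sμ : ℝ → OrnsteinUhlenbeck.RKHSpace hμ.isPosSymm →L[ℝ]
      OrnsteinUhlenbeck.RKHSpace hμ.isPosSymm := fun t =>
    if ht : 0 < t then T t ht else ContinuousLinearMap.id ℝ _
  have hSμ : ∀ t (ht : 0 < t), Sμ t = T t ht := fun t ht => dif_pos ht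
  have hSμ0 : Sμ 0 = ContinuousLinearMap.id ℝ _ := dif_neg (lt_irrefl 0)
  have hembed : ∀ t : ℝ, 0 ≤ t → ∀ h, OrnsteinUhlenbeck.RKHSpace.embed hμ.isPosSymm (Sμ t h) =
      S t (OrnsteinUhlenbeck.RKHSpace.embed hμ.isPosSymm h) := fun t ht h => by
    rcases ht.eq_or_lt with rfl | ht
    · rw [hSμ0, hS.map_zero]
      rfl
    · rw [hSμ t ht, hT t ht]
  have hle : ∀ t : ℝ, 0 ≤ t → ‖Sμ t‖ ≤ 1 := fun t ht => by
    rcases ht.eq_or_lt with rfl | ht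
    · rw [hSμ0]
      exact ContinuousLinearMap.norm_id_le
    · rw [hSμ t ht]
      exact (hTn t ht).le
  refine ⟨Sμ, hembed, OrnsteinUhlenbeck.isC0Semigroup_of_embed_eq hμ.isPosSymm hS hembed hle,
    fun t ht => ?_, fun t ht => ?_⟩
  · rw [hSμ t ht]
    exact hTc t ht
  · rw [hSμ t ht]
    exact hTn t ht
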